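/- Let $(X,\mathcal A)$ be a ringed space, i.e. a topological space $X$ with a sheaf of (not necessarily commutative) rings $\mathcal A$. For $U\subset X$ open, let $\mathsf{Mod}\,\mathcal A|_U$ be the category of sheaves of left $\mathcal A|_U$-modules and $\mathsf D(\mathsf{Mod}\,\mathcal A|_U)$ its derived category; $\mathcal M\mapsto\mathcal M|_V$ denotes restriction. All full subcategories are closed under isomorphism. A family of full subcategories $\mathsf C(U)\subset\mathsf D(\mathsf{Mod}\,\mathcal A|_U)$, $U\subset X$ open, is called a *stack of subcategories of* $\mathsf D(\mathsf{Mod}\,\mathcal A)$ if: (a) for $V\subset U$ open and $\mathcal M\in\mathsf C(U)$ one has $\mathcal M|_V\in\mathsf C(V)$; (b) (descent for objects) given an open covering $U=\bigcup_i V_i$, objects $\mathcal M_i\in\mathsf C(V_i)$ and isomorphisms $\phi_{i,j}:\mathcal M_i|_{V_i\cap V_j}\to\mathcal M_j|_{V_i\cap V_j}$ with $\phi_{i,k}=\phi_{j,k}\circ\phi_{i,j}$ on $V_i\cap V_j\cap V_k$, there exist $\mathcal M\in\mathsf C(U)$ and isomorphisms $\phi_i:\mathcal M|_{V_i}\to\mathcal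 M_i$ such that $\phi_{i,j}\circ\phi_i=\phi_j$ on $V_i\cap V_j$; (c) (descent for morphisms) given $\mathcal M,\mathcal N\in\mathsf C(U)$, an open covering $U=\bigcup_i V_i$ and morphisms $\psi_i:\mathcal M|_{V_i}\to\mathcal N|_{V_i}$ with $\psi_i|_{V_i\cap V_j}=\psi_j|_{V_i\cap V_j}$, there is a unique morphism $\psi:\mathcal M\to\mathcal N$ with $\psi|_{V_i}=\psi_i$ for all $i$. Let $\mathsf C$ be a thick abelian substack of $\mathsf{Mod}\,\mathcal A$: a family of thick abelian subcategories $\mathsf C(U)\subset\mathsf{Mod}\,\mathcal A|_U$ (containing $0$ and closed under kernels, cokernels and extensions) which, when $\mathsf{Mod}\,\mathcal A|_U$ is identified with the heart of the standard t-structure on $\mathsf D(\mathsf{Mod}\,\mathcal A|_U)$, is a stack of subcategories of $\mathsf D(\mathsf{Mod}\,\mathcal A)$. Let $\mathsf D^{\mathrm b}_{\mathrm c}(\mathsf{Mod}\,\mathcal A|_U)\subset\mathsf D(\mathsf{Mod}\,\mathcal A|_U)$ be the full triangulated subcategory of bounded complexes $\mathcal M$ with $\mathrm H^i\mathcal M\in\mathsf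 C(U)$ for all $i$. Let $\mathfrak B$ be a basis of the topology of $X$, and let $\{\mathfrak T_U\}_{U\in\mathfrak B}$ be a local collection of t-structures: for each $U\in\mathfrak B$, $$\mathfrak T_U=\bigl({}^p\mathsf D^{\mathrm b}_{\mathrm c}(\mathsf{Mod}\,\mathcal A|_U)^{\le0},\ {}^p\mathsf D^{\mathrm b}_{\mathrm c}(\mathsf{Mod}\,\mathcal A|_U)^{\ge0}\bigr)$$ is a t-structure on $\mathsf D^{\mathrm b}_{\mathrm c}(\mathsf{Mod}\,\mathcal A|_U)$, and whenever $U\in\mathfrak B$ is covered by $U_i\in\mathfrak B$ (with $U=\bigcup_i U_i$), for $\star\in\{\le0,\ge0\}$ and $\mathcal M\in\mathsf D^{\mathrm b}_{\mathrm c}(\mathsf{Mod}\,\mathcal A|_U)$ one has $\mathcal M\in{}^p\mathsf D^{\mathrm b}_{\mathrm c}(\mathsf{Mod}\,\mathcal A|_U)^{\star}$ if and only if $\mathcal M|_{U_i}\in{}^p\mathsf D^{\mathrm b}_{\mathrm c}(\mathsf{Mod}\,\mathcal A|_{U_i})^{\star}$ for all $i$. For an arbitrary open set $V\subset X$ and $\star\in\{\le0,\ge0\}$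 let ${}^p\mathsf D^{\mathrm b}_{\mathrm c}(\mathsf{Mod}\,\mathcal A|_V)^{\star}$ be the full subcategory of those $\mathcal M\in\mathsf D^{\mathrm b}_{\mathrm c}(\mathsf{Mod}\,\mathcal A|_V)$ with $\mathcal M|_U\in{}^p\mathsf D^{\mathrm b}_{\mathrm c}(\mathsf{Mod}\,\mathcal A|_U)^{\star}$ for every $U\in\mathfrak B$ with $U\subset V$ (the glued t-structure), and let its heart be $${}^p\mathsf D^{\mathrm b}_{\mathrm c}(\mathsf{Mod}\,\mathcal A|_V)^{0}:={}^p\mathsf D^{\mathrm b}_{\mathrm c}(\mathsf{Mod}\,\mathcal A|_V)^{\le0}\cap{}^p\mathsf D^{\mathrm b}_{\mathrm c}(\mathsf{Mod}\,\mathcal A|_V)^{\ge0}.$$ **Theorem.** If $X$ is a noetherian topological space, then $V\mapsto{}^p\mathsf D^{\mathrm b}_{\mathrm c}(\mathsf{Mod}\,\mathcal A|_V)^{0}$, for $V\subset X$ open, is a stack of subcategories of $\mathsf D(\mathsf{Mod}\,\mathcal A)$ (with all objects over $V$ in $\mathsf D^{\mathrm b}_{\mathrm c}(\mathsf{Mod}\,\mathcal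 A|_V)$). -/

import Mathlib

open CategoryTheory CategoryTheory.Limits CategoryTheory.Triangulated TopologicalSpace

universe u

noncomputable section

namespace RingedStack

/-- A (full) thick abelian subcategory of an abelian category: it contains a zero object and is
closed under kernels, cokernels and extensions (in particular under isomorphisms). -/
class IsThickAbelian {C : Type*} [Category* C] [Abelian C] (P : ObjectProperty C) : Prop
    extends P.ContainsZero, P.IsClosedUnderKernels, P.IsClosedUnderCokernels,
      P.IsClosedUnderExtensions

instance {C : Type*} [Category* C] [Abelian C] (P : ObjectProperty C) [IsThickAbelian P] :
    P.IsClosedUnderIsomorphisms where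
  of_iso {Y Z} e hY := by
    obtain ⟨O, hO, hPO⟩ := ObjectProperty.ContainsZero.exists_zero (P := P)
    exact P.prop_X₂_of_shortExact (S := ShortComplex.mk e.hom (0 : Z ⟶ O) (by simp))
      { exact := (ShortComplex.exact_iff_epi _ rfl).2 inferInstance
        epi_g := ⟨fun _ _ _ => hO.eq_of_src _ _⟩ } hY hPO

/-- The five term property of a thick abelian subcategory. -/
lemma IsThickAbelian.prop_of_exact {C : Type*} [Category* C] [Abelian C] (P : ObjectProperty C)
    [IsThickAbelian P] {A₁ A₂ A₃ A₄ A₅ : C} (f₁ : A₁ ⟶ A₂) (f₂ : A₂ ⟶ A₃) (f₃ : A₃ ⟶ A₄)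
    (f₄ : A₄ ⟶ A₅) (w₁ : f₁ ≫ f₂ = 0) (w₂ : f₂ ≫ f₃ = 0) (w₃ : f₃ ≫ f₄ = 0)
    (h₁ : (ShortComplex.mk f₁ f₂ w₁).Exact) (h₂ : (ShortComplex.mk f₂ f₃ w₂).Exact)
    (h₃ : (ShortComplex.mk f₃ f₄ w₃).Exact)
    (hA₁ : P A₁) (hA₂ : P A₂) (hA₄ : P A₄) (hA₅ : P A₅) : P A₃ := by
  have hK := P.prop_cokernel f₁ hA₁ hA₂
  have hL := P.prop_kernel f₄ hA₄ hA₅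
  have w : cokernel.desc f₁ f₂ w₁ ≫ kernel.lift f₄ f₃ w₃ = 0 := by
    rw [← cancel_epi (cokernel.π f₁), ← cancel_mono (kernel.ι f₄)]
    simpa using w₂
  have hmono : Mono (cokernel.desc f₁ f₂ w₁) := h₁.mono_cokernelDesc
  have hepi : Epi (kernel.lift f₄ f₃ w₃) := h₃.epi_kernelLift
  refine P.prop_X₂_of_shortExact (S := ShortComplex.mk _ _ w)
    { exact := ?_, mono_f := hmono, epi_g := hepi } hK hL
  let a : ShortComplex.mk f₂ (kernel.lift f₄ f₃ w₃) (by
      rw [← cancel_mono (kernel.ι f₄)]; simpa using w₂) ⟶ ShortComplex.mk f₂ f₃ w₂ :=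
    { τ₁ := 𝟙 _, τ₂ := 𝟙 _, τ₃ := kernel.ι f₄ }
  let b : ShortComplex.mk f₂ (kernel.lift f₄ f₃ w₃) (by
      rw [← cancel_mono (kernel.ι f₄)]; simpa using w₂) ⟶ ShortComplex.mk _ _ w :=
    { τ₁ := cokernel.π f₁, τ₂ := 𝟙 _, τ₃ := 𝟙 _ }
  have : Epi a.τ₁ := inferInstanceAs (Epi (𝟙 _))
  have : IsIso a.τ₂ := inferInstanceAs (IsIso (𝟙 _))
  have : Mono a.τ₃ := inferInstanceAs (Mono (kernel.ι f₄))
  have : Epi b.τ₁ := inferInstanceAs (Epi (cokernel.π f₁))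
  have : IsIso b.τ₂ := inferInstanceAs (IsIso (𝟙 _))
  have : Mono b.τ₃ := inferInstanceAs (Mono (𝟙 _))
  rw [← ShortComplex.exact_iff_of_epi_of_isIso_of_mono b,
    ShortComplex.exact_iff_of_epi_of_isIso_of_mono a]
  exact h₂

/-- The cohomologically bounded objects of a derived category whose cohomology objects
all satisfy `P`. -/
def boundedWithHomology {C : Type*} [Category* C] [Abelian C] [HasDerivedCategory C]
    (P : ObjectProperty C) : ObjectProperty (DerivedCategory C) := fun M =>
  DerivedCategory.TStructure.t.bounded M ∧ ∀ i : ℤ, P ((DerivedCategory.homologyFunctor C i).obj M)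

instance {C : Type*} [Category* C] [Abelian C] [HasDerivedCategory C]
    (P : ObjectProperty C) [IsThickAbelian P] :
    (boundedWithHomology P).IsClosedUnderIsomorphisms where
  of_iso e h := ⟨(ObjectProperty.prop_iff_of_iso _ e).1 h.1, fun i =>
    (P.prop_iff_of_iso ((DerivedCategory.homologyFunctor C i).mapIso e)).1 (h.2 i)⟩

open DerivedCategory in
instance {C : Type*} [Category* C] [Abelian C] [HasDerivedCategory C]
    (P : ObjectProperty C) [IsThickAbelian P] : (boundedWithHomology P).IsTriangulated where
  exists_zero := by
    obtain ⟨Z, hZ, hb⟩ :=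
      ObjectProperty.ContainsZero.exists_zero (P := (TStructure.t (C := C)).bounded)
    exact ⟨Z, hZ, hb, fun i => P.prop_of_isZero ((homologyFunctor C i).map_isZero hZ)⟩
  isStableUnderShiftBy n :=
    { le_shift := fun M hM => ⟨(TStructure.t (C := C)).bounded.le_shift n M hM.1, fun i =>
        (P.prop_iff_of_iso (((homologyFunctor C 0).shiftIso n i (n + i) rfl).app M)).2
          (hM.2 (n + i))⟩ }
  toIsTriangulatedClosed₂ := .mk' fun T hT h₁ h₃ => by
    refine ⟨?_, fun i => ?_⟩
    · exact ObjectProperty.ext_of_isTriangulatedClosed₂ _ T hT h₁.1 h₃.1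
    · exact IsThickAbelian.prop_of_exact P _ _ _ _ _ _ _
        (HomologySequence.exact₁ T hT (i - 1) i) (HomologySequence.exact₂ T hT i)
        (HomologySequence.exact₃ T hT i (i + 1)) (h₃.2 _) (h₁.2 _) (h₃.2 _) (h₁.2 _)

variable {X : TopCat.{u}}

/-- The category `Mod 𝒜|_U` of sheaves of left modules over the restriction to the open set `U`
of a sheaf of (not necessarily commutative) rings `𝒜` on `X`. Sheaves on the open subspace `U` are
encoded as sheaves on the site of all open sets contained in `U`. -/
abbrev ModOn (A : X.Sheaf RingCat.{u}) (U : Opens X) : Type (u + 1) :=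
  SheafOfModules.{u} (Sheaf.over A U)

/-- The restriction functor `Mod 𝒜|_U ⥤ Mod 𝒜|_V` for `V ⊆ U`. -/
def ModOn.res (A : X.Sheaf RingCat.{u}) {U V : Opens X} (h : V ≤ U) : ModOn A U ⥤ ModOn A V :=
  SheafOfModules.overMap A (homOfLE h)

instance (A : X.Sheaf RingCat.{u}) {U V : Opens X} (h : V ≤ U) :
    (ModOn.res A h).IsLeftAdjoint :=
  (SheafOfModules.overMapPushforwardAdj A (homOfLE h)).isLeftAdjoint

instance (A : X.Sheaf RingCat.{u}) {U V : Opens X} (h : V ≤ U) :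
    (ModOn.res A h).IsRightAdjoint := by
  have : (PresheafOfModules.pushforward.{u}
      (Sheaf.pushforwardOverMapIso A (homOfLE h)).inv.hom).IsRightAdjoint := by
    apply PresheafOfModules.instIsRightAdjointPushforward
  unfold ModOn.res SheafOfModules.overMap
  infer_instance

instance (A : X.Sheaf RingCat.{u}) {U V : Opens X} (h : V ≤ U) : (ModOn.res A h).Additive where

/-- The canonical identification `(M|_V)|_W ≅ M|_W`, given by identity maps on sections. -/
def ModOn.resComp (A : X.Sheaf RingCat.{u}) {U V W : Opens X} (h : V ≤ U) (h' : W ≤ V) :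
    ModOn.res A h ⋙ ModOn.res A h' ≅ ModOn.res A (h'.trans h) :=
  NatIso.ofComponents
    fun M => (SheafOfModules.fullyFaithfulForget _).preimageIso <|
      PresheafOfModules.isoMk (fun _ => Iso.refl _)

instance (A : X.Sheaf RingCat.{u}) (U : Opens X) : HasDerivedCategory.{u + 1} (ModOn A U) :=
  HasDerivedCategory.standard _

/-- The derived category `D(Mod 𝒜|_U)`. -/
abbrev D (A : X.Sheaf RingCat.{u}) (U : Opens X) : Type (u + 1) := DerivedCategory (ModOn A U)

/-- The restriction functor `M ↦ M|_V` from `D(Mod 𝒜|_U)` to `D(Mod 𝒜|_V)`, induced by the exact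
functor `ModOn.res`. -/
def res (A : X.Sheaf RingCat.{u}) {U V : Opens X} (h : V ≤ U) : D A U ⥤ D A V :=
  (ModOn.res A h).mapDerivedCategory

/-- The canonical isomorphism `(M|_V)|_W ≅ M|_W` in the derived category, induced by
`ModOn.resComp`. -/
def resComp (A : X.Sheaf RingCat.{u}) {U V W : Opens X} (h : V ≤ U) (h' : W ≤ V) :
    res A h ⋙ res A h' ≅ res A (h'.trans h) :=
  letI : Localization.Lifting DerivedCategory.Q
      (HomologicalComplex.quasiIso (ModOn A U) (ComplexShape.up ℤ))
      (((ModOn.res A h).mapHomologicalComplex _ ⋙ (ModOn.res A h').mapHomologicalComplex _) ⋙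
        DerivedCategory.Q) (res A h ⋙ res A h') :=
    ⟨(Functor.associator _ _ _).symm ≪≫
      Functor.isoWhiskerRight (ModOn.res A h).mapDerivedCategoryFactors _ ≪≫
      Functor.associator _ _ _ ≪≫
      Functor.isoWhiskerLeft _ (ModOn.res A h').mapDerivedCategoryFactors ≪≫
      (Functor.associator _ _ _).symm⟩
  letI : Localization.Lifting DerivedCategory.Q
      (HomologicalComplex.quasiIso (ModOn A U) (ComplexShape.up ℤ))
      ((ModOn.res A (h'.trans h)).mapHomologicalComplex _ ⋙ DerivedCategory.Q)
      (res A (h'.trans h)) :=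
    ⟨(ModOn.res A (h'.trans h)).mapDerivedCategoryFactors⟩
  Localization.liftNatIso DerivedCategory.Q
    (HomologicalComplex.quasiIso (ModOn A U) (ComplexShape.up ℤ))
    (((ModOn.res A h).mapHomologicalComplex _ ⋙ (ModOn.res A h').mapHomologicalComplex _) ⋙
      DerivedCategory.Q)
    ((ModOn.res A (h'.trans h)).mapHomologicalComplex _ ⋙ DerivedCategory.Q) _ _
    (Functor.isoWhiskerRight
      (Functor.mapHomologicalComplexCompIso (ModOn.resComp A h h') (ComplexShape.up ℤ)) _)

/-- The restriction `f|_W : M|_W ⟶ N|_W` of a morphism `f : M|_V ⟶ N|_V`, for `W ⊆ V`. -/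
def resHom {A : X.Sheaf RingCat.{u}} {U U' V W : Opens X} {M : D A U} {N : D A U'}
    {h : V ≤ U} {h' : V ≤ U'} (f : (res A h).obj M ⟶ (res A h').obj N) (hW : W ≤ V) :
    (res A (hW.trans h)).obj M ⟶ (res A (hW.trans h')).obj N :=
  (resComp A h hW).inv.app M ≫ (res A hW).map f ≫ (resComp A h' hW).hom.app N

/-- A family of full subcategories `C(U) ⊆ D(Mod 𝒜|_U)`, for `U` open in `X`, is a stack of
subcategories of `D(Mod 𝒜)`. -/
structure IsStack {A : X.Sheaf RingCat.{u}} (C : ∀ U : Opens X, ObjectProperty (D A U)) :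
    Prop where
  /-- Stability under restriction. -/
  res_mem {U V : Opens X} (h : V ≤ U) (M : D A U) (hM : C U M) : C V ((res A h).obj M)
  /-- Descent for objects. -/
  descent_obj {U : Opens X} {ι : Type u} (V : ι → Opens X) (hV : ∀ i, V i ≤ U)
    (hcov : U = ⨆ i, V i) (M : ∀ i, D A (V i)) (hM : ∀ i, C (V i) (M i))
    (φ : ∀ i j, (res A (inf_le_left : V i ⊓ V j ≤ V i)).obj (M i) ≅
      (res A (inf_le_right : V i ⊓ V j ≤ V j)).obj (M j))
    (hφ : ∀ i j k,
      resHom (φ i k).hom (le_inf (inf_le_left.trans inf_le_left) inf_le_right :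
          V i ⊓ V j ⊓ V k ≤ V i ⊓ V k) =
        resHom (φ i j).hom (inf_le_left : V i ⊓ V j ⊓ V k ≤ V i ⊓ V j) ≫
          resHom (φ j k).hom (le_inf (inf_le_left.trans inf_le_right) inf_le_right :
            V i ⊓ V j ⊓ V k ≤ V j ⊓ V k)) :
    ∃ (N : D A U) (_ : C U N) (ψ : ∀ i, (res A (hV i)).obj N ≅ M i), ∀ i j,
      ((resComp A (hV i) (inf_le_left : V i ⊓ V j ≤ V i)).inv.app N ≫
          (res A inf_le_left).map (ψ i).hom) ≫ (φ i j).hom =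
        (resComp A (hV j) (inf_le_right : V i ⊓ V j ≤ V j)).inv.app N ≫
          (res A inf_le_right).map (ψ j).hom
  /-- Descent for morphisms. -/
  descent_hom {U : Opens X} {ι : Type u} (V : ι → Opens X) (hV : ∀ i, V i ≤ U)
    (hcov : U = ⨆ i, V i) (M N : D A U) (hM : C U M) (hN : C U N)
    (ψ : ∀ i, (res A (hV i)).obj M ⟶ (res A (hV i)).obj N)
    (hψ : ∀ i j, resHom (ψ i) (inf_le_left : V i ⊓ V j ≤ V i) =
      resHom (ψ j) (inf_le_right : V i ⊓ V j ≤ V j)) :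
    ∃! f : M ⟶ N, ∀ i, (res A (hV i)).map f = ψ i

/-- A thick abelian substack of `Mod 𝒜`: a family of thick abelian subcategories
`C(U) ⊆ Mod 𝒜|_U` which, through the identification of `Mod 𝒜|_U` with the heart `D(Mod 𝒜|_U)⁰` of
the standard t-structure (complexes concentrated in degree `0`), is a stack of subcategories of
`D(Mod 𝒜)`. -/
structure ThickAbelianSubstack (A : X.Sheaf RingCat.{u}) where
  /-- The objects of `C(U)`. -/
  obj (U : Opens X) : ObjectProperty (ModOn A U)
  thick (U : Opens X) : IsThickAbelian (obj U)
  isStack : IsStack fun U => (obj U).map (DerivedCategory.singleFunctor (ModOn A U) 0)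

attribute [instance] ThickAbelianSubstack.thick

/-- The triangulated subcategory `D^b_c(Mod 𝒜|_U)` of `D(Mod 𝒜|_U)`: bounded complexes with
cohomology in `C(U)`. -/
abbrev Dbc {A : X.Sheaf RingCat.{u}} (C : ThickAbelianSubstack A) (U : Opens X) :
    ObjectProperty (D A U) :=
  boundedWithHomology (C.obj U)

/-- Cohomology commutes with restriction. -/
def homologyResIso (A : X.Sheaf RingCat.{u}) {U V : Opens X} (h : V ≤ U) (M : D A U) (i : ℤ) :
    (DerivedCategory.homologyFunctor (ModOn A V) i).obj ((res A h).obj M) ≅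
      (ModOn.res A h).obj ((DerivedCategory.homologyFunctor (ModOn A U) i).obj M) :=
  let K := DerivedCategory.Q.objPreimage M
  let e : DerivedCategory.Q.obj K ≅ M := DerivedCategory.Q.objObjPreimageIso M
  (DerivedCategory.homologyFunctor _ i).mapIso ((res A h).mapIso e.symm ≪≫
      (ModOn.res A h).mapDerivedCategoryFactors.app K) ≪≫
    (DerivedCategory.homologyFunctorFactors _ i).app _ ≪≫
    (K.sc i).mapHomologyIso (ModOn.res A h) ≪≫
    (ModOn.res A h).mapIso ((DerivedCategory.homologyFunctorFactors _ i).symm.app K ≪≫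
      (DerivedCategory.homologyFunctor _ i).mapIso e)

lemma ThickAbelianSubstack.res_mem {A : X.Sheaf RingCat.{u}} (C : ThickAbelianSubstack A)
    {U V : Opens X} (h : V ≤ U) (M : ModOn A U) (hM : C.obj U M) :
    C.obj V ((ModOn.res A h).obj M) := by
  have hM' : (C.obj U).map (DerivedCategory.singleFunctor (ModOn A U) 0)
      ((DerivedCategory.singleFunctor (ModOn A U) 0).obj M) :=
    ObjectProperty.prop_map_obj _ _ hM
  obtain ⟨N, hN, ⟨e⟩⟩ := C.isStack.res_mem h _ hM'
  let e' : (DerivedCategory.singleFunctor (ModOn A V) 0).obj N ≅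
      (DerivedCategory.singleFunctor (ModOn A V) 0).obj ((ModOn.res A h).obj M) :=
    e ≪≫ ((ModOn.res A h).mapDerivedCategorySingleFunctor 0).app M
  exact ((C.obj V).prop_iff_of_iso
    ((DerivedCategory.singleFunctor (ModOn A V) 0).preimageIso e')).1 hN

lemma res_mem_Dbc {A : X.Sheaf RingCat.{u}} (C : ThickAbelianSubstack A) {U V : Opens X}
    (h : V ≤ U) (M : D A U) (hM : Dbc C U M) : Dbc C V ((res A h).obj M) := by
  obtain ⟨⟨⟨a, ha⟩, ⟨b, hb⟩⟩, hC⟩ := hM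
  refine ⟨⟨⟨a, ?_⟩, ⟨b, ?_⟩⟩, fun i => ?_⟩
  · exact (DerivedCategory.isGE_iff _ _).2 fun i hi =>
      (((ModOn.res A h).map_isZero ((DerivedCategory.isGE_iff _ _).1 ha i hi))).of_iso
        (homologyResIso A h M i)
  · exact (DerivedCategory.isLE_iff _ _).2 fun i hi =>
      (((ModOn.res A h).map_isZero ((DerivedCategory.isLE_iff _ _).1 hb i hi))).of_iso
        (homologyResIso A h M i)
  · exact ((C.obj V).prop_iff_of_iso (homologyResIso A h M i)).2 (C.res_mem h _ (hC i))

/-- The restriction functor `D^b_c(Mod 𝒜|_U) ⥤ D^b_c(Mod 𝒜|_V)` for `V ⊆ U`. -/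
def Dbc.res {A : X.Sheaf RingCat.{u}} (C : ThickAbelianSubstack A) {U V : Opens X} (h : V ≤ U) :
    (Dbc C U).FullSubcategory ⥤ (Dbc C V).FullSubcategory :=
  (Dbc C V).lift ((Dbc C U).ι ⋙ RingedStack.res A h) fun M => res_mem_Dbc C h M.obj M.property

/-- A local collection of t-structures `{𝔗_U}` on `(X, 𝒜)`, indexed by a set `B` of open sets:
a t-structure on each `D^b_c(Mod 𝒜|_U)`, `U ∈ B`, such that for every covering of some `U ∈ B` by
members of `B`, an object is `≤ 0` (resp. `≥ 0`) if and only if all of its restrictions to the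
members of the covering are. -/
structure LocalTStructures {A : X.Sheaf RingCat.{u}} (C : ThickAbelianSubstack A)
    (B : Set (Opens X)) where
  /-- The t-structure `𝔗_U` on `D^b_c(Mod 𝒜|_U)`. -/
  t (U : Opens X) (hU : U ∈ B) : TStructure (Dbc C U).FullSubcategory
  le_iff (U : Opens X) (hU : U ∈ B) {ι : Type u} (V : ι → Opens X) (hVB : ∀ i, V i ∈ B)
    (hV : ∀ i, V i ≤ U) (hcov : U = ⨆ i, V i) (M : (Dbc C U).FullSubcategory) :
    (t U hU).le 0 M ↔ ∀ i, (t (V i) (hVB i)).le 0 ((Dbc.res C (hV i)).obj M)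
  ge_iff (U : Opens X) (hU : U ∈ B) {ι : Type u} (V : ι → Opens X) (hVB : ∀ i, V i ∈ B)
    (hV : ∀ i, V i ≤ U) (hcov : U = ⨆ i, V i) (M : (Dbc C U).FullSubcategory) :
    (t U hU).ge 0 M ↔ ∀ i, (t (V i) (hVB i)).ge 0 ((Dbc.res C (hV i)).obj M)

namespace LocalTStructures

variable {A : X.Sheaf RingCat.{u}} {C : ThickAbelianSubstack A} {B : Set (Opens X)}
  (T : LocalTStructures C B)

/-- The full subcategory `ᵖD^b_c(Mod 𝒜|_V)^{≤ 0}` of the glued t-structure over an arbitrary open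
set `V` (not necessarily in `B`): the objects whose restriction to each `U ∈ B` contained in `V` is `≤ 0` for `𝔗_U`. -/
def gluedLE (V : Opens X) : ObjectProperty (Dbc C V).FullSubcategory := fun M =>
  ∀ (U : Opens X) (hU : U ∈ B) (h : U ≤ V), (T.t U hU).le 0 ((Dbc.res C h).obj M)

/-- The full subcategory `ᵖD^b_c(Mod 𝒜|_V)^{≥ 0}` of the glued t-structure over `V`. -/
def gluedGE (V : Opens X) : ObjectProperty (Dbc C V).FullSubcategory := fun M =>
  ∀ (U : Opens X) (hU : U ∈ B) (h : U ≤ V), (T.t U hU).ge 0 ((Dbc.res C h).obj M)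

/-- The heart `ᵖD^b_c(Mod 𝒜|_V)⁰` of the glued t-structure over `V`, as a full subcategory of
`D(Mod 𝒜|_V)`: the intersection of its `≤ 0` and `≥ 0` parts. -/
def heart (V : Opens X) : ObjectProperty (D A V) := fun M =>
  ∃ hM : Dbc C V M, T.gluedLE V ⟨M, hM⟩ ∧ T.gluedGE V ⟨M, hM⟩

end LocalTStructures

end RingedStack

end

open RingedStack

/-!
Let `j : V → U` be an inclusion of open sets. Restriction `M ↦ M|_V` has an exact left adjoint
`j_!`, extension by zero (`lower`), so that the restriction functors of derived categories have
left adjoints as well (`lowerD`, `lowerDAdj`). For `U = V₁ ∪ V₂`, `W = V₁ ∩ V₂` and objects `M₁`,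
`M₂` with an isomorphism between their restrictions to `W`, the cone of
`j_{W!} M₁|_W ⟶ j_{1!} M₁ ⊕ j_{2!} M₂` restricts to `M₁` and to `M₂` (`exists_cone`): two objects
of the derived category can always be glued (`exists_glue`). Applied to the restrictions of an
object `M` over `U` the same triangle is the Mayer-Vietoris triangle of `M`
(`exists_mayerVietoris`). Hence two morphisms over `V₁` and `V₂` that agree over `W` can be glued,
and the glued morphism is unique as soon as morphisms `M|_W ⟶ N⟦-1⟧|_W` vanish.

As `X` is noetherian, all coverings have finite subcoverings, and induction gives descent for
morphisms `M ⟶ N` whenever morphisms from `M` to `N⟦-1⟧` vanish over all smaller open sets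
(`hom_ext_of_cover`, `exists_hom_of_cover`). If `M` is `≤ 0` and `N` is `≥ 0` for the glued
t-structure, all morphisms `M ⟶ N⟦n⟧` with `n < 0` vanish (`homVanishes_shift`): this holds over
the members of the basis by the axioms of t-structures, it holds for `n` very negative by
boundedness, and it propagates from `n - 1` to `n` by the uniqueness part of descent.
This settles descent for morphisms. The heart is a local condition (`heart_of_cover`), where
the local nature of `D^b_c` comes from the fact that the thick abelian substack satisfies descent.

For objects, a descent datum is glued one open set at a time. The induction
hypothesis `HasDescent` over an open set `W` provides an object over `W` with compatible
isomorphisms over `W ∩ V_k` for *all* members of the covering, not only those contained in `W`;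
it passes from `W` to `W ∪ V_k` by gluing two objects, and descent for morphisms in
the heart extends the isomorphisms (`HasDescent.sup`).
-/

noncomputable section

namespace RingedStack

/-! ### Extension by zero of sheaves of modules -/

section

variable {X : TopCat.{u}}

/-- The restriction functor `ModOn.res` on the level of presheaves of modules. -/
def presheafRes (A : X.Sheaf RingCat.{u}) {U V : Opens X} (h : V ≤ U) :
    PresheafOfModules.{u} (Sheaf.over A U).obj ⥤ PresheafOfModules.{u} (Sheaf.over A V).obj :=
  PresheafOfModules.pushforward (Sheaf.pushforwardOverMapIso A (homOfLE h)).inv.hom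

/-- An open subset `W` of `V` as an object of the site of open subsets of `V`. -/
abbrev opOver {V W : Opens X} (h : W ≤ V) : (Over V)ᵒᵖ := .op (Over.mk (homOfLE h))

/-- The morphism in the opposite of the site of `V` given by an inclusion `W' ≤ W`. -/
abbrev opOverHom {V W W' : Opens X} (h : W ≤ V) (h' : W' ≤ V) (i : W' ≤ W) :
    opOver h ⟶ opOver h' :=
  (Over.homMk (U := Over.mk (homOfLE h')) (V := Over.mk (homOfLE h)) (homOfLE i)).op

instance {V : Opens X} (W W' : (Over V)ᵒᵖ) : Subsingleton (W ⟶ W') where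
  allEq f g := by
    apply Quiver.Hom.unop_inj
    ext1
    exact Subsingleton.elim _ _

open Classical in
/-- The presheaf of abelian groups underlying the extension by zero of `F`. Its sections over `W`
are functions from the proofs of `W ≤ V` to the sections of `F`, which avoids a case distinction
in the definition of the objects. -/
def extZeroAb {A : X.Sheaf RingCat.{u}} {U V : Opens X} (_ : V ≤ U)
    (F : PresheafOfModules.{u} (Sheaf.over A V).obj) : (Over U)ᵒᵖ ⥤ Ab.{u} where
  obj W := AddCommGrpCat.of (∀ i : PLift (W.unop.left ≤ V), F.obj (opOver i.down))
  map {W W'} f := AddCommGrpCat.ofHom (AddMonoidHom.mk' (fun s i =>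
      if hW : W.unop.left ≤ V then
        F.map (opOverHom hW i.down (leOfHom f.unop.left)) (s ⟨hW⟩) else 0) (by
      intro s t
      ext i
      by_cases hW : W.unop.left ≤ V
      · simp only [hW, ↓reduceDIte]
        exact map_add (F.map (opOverHom hW i.down (leOfHom f.unop.left))).hom _ _
      · simp only [hW, ↓reduceDIte]
        exact (add_zero _).symm))
  map_id W := ConcreteCategory.hom_ext _ _ fun s => funext fun i =>
    (dif_pos i.down).trans <|
      (F.congr_map_apply (g := 𝟙 _) (Subsingleton.elim _ _) _).trans (by simp; rfl)
  map_comp {W W' W''} f g := ConcreteCategory.hom_ext _ _ fun s => funext fun i => by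
    have hW' (h : W.unop.left ≤ V) : W'.unop.left ≤ V := (leOfHom f.unop.left).trans h
    by_cases hW : W.unop.left ≤ V
    · refine (dif_pos hW).trans ?_
      refine .trans ?_ ((dif_pos (hW' hW)).trans
        (congrArg (F.map (opOverHom (hW' hW) i.down (leOfHom g.unop.left))) (dif_pos hW))).symm
      refine .trans ?_ (PresheafOfModules.map_comp_apply F
        (opOverHom hW (hW' hW) (leOfHom f.unop.left))
        (opOverHom (hW' hW) i.down (leOfHom g.unop.left)) (s ⟨hW⟩))
      exact F.congr_map_apply (Subsingleton.elim _ _) _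
    · refine (dif_neg hW).trans ?_
      by_cases hW' : W'.unop.left ≤ V
      · refine .trans ?_ ((dif_pos hW').trans
          (congrArg (F.map (opOverHom hW' i.down (leOfHom g.unop.left))) (dif_neg hW))).symm
        exact (map_zero (F.map (opOverHom hW' i.down (leOfHom g.unop.left))).hom).symm
      · exact .symm (dif_neg hW')

lemma extZeroAb_map_of_le {A : X.Sheaf RingCat.{u}} {U V : Opens X} (h : V ≤ U)
    (F : PresheafOfModules.{u} (Sheaf.over A V).obj) {W W' : (Over U)ᵒᵖ} (f : W ⟶ W')
    (hW : W.unop.left ≤ V) (i : PLift (W'.unop.left ≤ V)) (s : (extZeroAb h F).obj W) :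
    (extZeroAb h F).map f s i =
      F.map (opOverHom hW i.down (leOfHom f.unop.left)) (s ⟨hW⟩) :=
  dif_pos hW

lemma extZeroAb_map_of_not_le {A : X.Sheaf RingCat.{u}} {U V : Opens X} (h : V ≤ U)
    (F : PresheafOfModules.{u} (Sheaf.over A V).obj) {W W' : (Over U)ᵒᵖ} (f : W ⟶ W')
    (hW : ¬ W.unop.left ≤ V) (i : PLift (W'.unop.left ≤ V)) (s : (extZeroAb h F).obj W) :
    (extZeroAb h F).map f s i = 0 :=
  dif_neg hW

instance {A : X.Sheaf RingCat.{u}} {U V : Opens X} (h : V ≤ U)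
    (F : PresheafOfModules.{u} (Sheaf.over A V).obj) (W : (Over U)ᵒᵖ) :
    Module ((Sheaf.over A U).obj.obj W) ((extZeroAb h F).obj W) where
  smul r s i :=
    letI r' : (Sheaf.over A V).obj.obj (opOver i.down) := r
    letI x : F.obj (opOver i.down) := s i
    r' • x
  one_smul _ := funext fun i => one_smul ((Sheaf.over A V).obj.obj (opOver i.down)) _
  mul_smul _ _ _ := funext fun i =>
    mul_smul (α := (Sheaf.over A V).obj.obj (opOver i.down)) _ _ _
  smul_zero _ := funext fun i =>
    smul_zero (M := (Sheaf.over A V).obj.obj (opOver i.down)) (A := F.obj (opOver i.down)) _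
  smul_add _ _ _ := funext fun i =>
    smul_add (M := (Sheaf.over A V).obj.obj (opOver i.down)) (A := F.obj (opOver i.down)) _ _ _
  add_smul _ _ _ := funext fun i =>
    add_smul (R := (Sheaf.over A V).obj.obj (opOver i.down)) (M := F.obj (opOver i.down)) _ _ _
  zero_smul _ := funext fun i =>
    zero_smul ((Sheaf.over A V).obj.obj (opOver i.down)) (A := F.obj (opOver i.down)) _

/-- The presheaf extension by zero of a presheaf of modules. -/
def extZeroObj {A : X.Sheaf RingCat.{u}} {U V : Opens X} (h : V ≤ U)
    (F : PresheafOfModules.{u} (Sheaf.over A V).obj) :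
    PresheafOfModules.{u} (Sheaf.over A U).obj :=
  PresheafOfModules.ofPresheaf (extZeroAb h F) (by
    intro W W' f r s
    funext i
    by_cases hW : W.unop.left ≤ V
    · refine (extZeroAb_map_of_le h F f hW i _).trans ?_
      refine (F.map_smul (opOverHom hW i.down (leOfHom f.unop.left)) r (s ⟨hW⟩)).trans ?_
      exact congrArg (fun x : F.obj (opOver i.down) =>
        ((Sheaf.over A V).obj.map (opOverHom hW i.down (leOfHom f.unop.left)) r) • x)
        (extZeroAb_map_of_le h F f hW i s).symm
    · refine (extZeroAb_map_of_not_le h F f hW i _).trans ?_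
      refine .trans ?_ (congrArg (fun x : F.obj (opOver i.down) =>
        (show (Sheaf.over A V).obj.obj (opOver i.down) from (Sheaf.over A U).obj.map f r) • x)
          (extZeroAb_map_of_not_le h F f hW i s).symm)
      exact (smul_zero _).symm)

/-- Presheaf extension by zero from `V` to `U`: its sections over `W` are those of `F` if `W ≤ V`
and zero otherwise. -/
def extZero (A : X.Sheaf RingCat.{u}) {U V : Opens X} (h : V ≤ U) :
    PresheafOfModules.{u} (Sheaf.over A V).obj ⥤ PresheafOfModules.{u} (Sheaf.over A U).obj where
  obj F := extZeroObj h F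
  map {F G} φ := PresheafOfModules.homMk
    { app W := AddCommGrpCat.ofHom (AddMonoidHom.mk' (fun s i => φ.app (opOver i.down) (s i))
        (fun s t => funext fun i => map_add (φ.app (opOver i.down)).hom _ _))
      naturality W W' f := by
        ext s
        funext i
        by_cases hW : W.unop.left ≤ V
        · refine (congrArg (φ.app (opOver i.down))
            (extZeroAb_map_of_le h F f hW i s)).trans ?_
          refine .trans ?_ (extZeroAb_map_of_le h G f hW i _).symm
          exact PresheafOfModules.naturality_apply φ _ _
        · refine (congrArg (φ.app (opOver i.down))
            (extZeroAb_map_of_not_le h F f hW i s)).trans ?_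
          refine .trans ?_ (extZeroAb_map_of_not_le h G f hW i _).symm
          exact map_zero (φ.app (opOver i.down)).hom }
    (fun W r s => funext fun i => (φ.app (opOver i.down)).hom.map_smul _ _)
  map_id F := rfl
  map_comp f g := rfl

instance (A : X.Sheaf RingCat.{u}) {U V : Opens X} (h : V ≤ U) :
    (extZero A h).PreservesMonomorphisms where
  preserves φ _ := PresheafOfModules.mono_of_injective fun _ _ _ hst =>
    funext fun i => PresheafOfModules.injective_of_mono φ (opOver i.down) (congrFun hst i)

open Classical in
/-- The value on sections of the morphism from an extension by zero which is induced by `ψ`. -/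
def extZeroDesc {A : X.Sheaf RingCat.{u}} {U V : Opens X} (h : V ≤ U)
    {F : PresheafOfModules.{u} (Sheaf.over A V).obj}
    {N : PresheafOfModules.{u} (Sheaf.over A U).obj} (ψ : F ⟶ (presheafRes A h).obj N)
    (W : (Over U)ᵒᵖ) (s : ((extZero A h).obj F).obj W) : N.obj W :=
  if hW : W.unop.left ≤ V then ψ.app (opOver hW) (s ⟨hW⟩) else 0

section

variable {A : X.Sheaf RingCat.{u}} {U V : Opens X} (h : V ≤ U)
  {F : PresheafOfModules.{u} (Sheaf.over A V).obj}
  {N : PresheafOfModules.{u} (Sheaf.over A U).obj} (ψ : F ⟶ (presheafRes A h).obj N)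
  {W : (Over U)ᵒᵖ}

lemma extZeroDesc_of_le (hW : W.unop.left ≤ V) (s : ((extZero A h).obj F).obj W) :
    extZeroDesc h ψ W s = ψ.app (opOver hW) (s ⟨hW⟩) :=
  dif_pos hW

lemma extZeroDesc_of_not_le (hW : ¬ W.unop.left ≤ V) (s : ((extZero A h).obj F).obj W) :
    extZeroDesc h ψ W s = 0 :=
  dif_neg hW

lemma extZeroDesc_add (s t : ((extZero A h).obj F).obj W) :
    extZeroDesc h ψ W (s + t) = extZeroDesc h ψ W s + extZeroDesc h ψ W t := by
  by_cases hW : W.unop.left ≤ V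
  · rw [extZeroDesc_of_le h ψ hW, extZeroDesc_of_le h ψ hW, extZeroDesc_of_le h ψ hW]
    exact map_add (ψ.app (opOver hW)).hom _ _
  · rw [extZeroDesc_of_not_le h ψ hW, extZeroDesc_of_not_le h ψ hW,
      extZeroDesc_of_not_le h ψ hW, add_zero]

lemma extZeroDesc_smul (r : (Sheaf.over A U).obj.obj W) (s : ((extZero A h).obj F).obj W) :
    extZeroDesc h ψ W (r • s) = r • extZeroDesc h ψ W s := by
  by_cases hW : W.unop.left ≤ V
  · rw [extZeroDesc_of_le h ψ hW, extZeroDesc_of_le h ψ hW]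
    exact (ψ.app (opOver hW)).hom.map_smul _ _
  · rw [extZeroDesc_of_not_le h ψ hW, extZeroDesc_of_not_le h ψ hW, smul_zero]

lemma extZeroDesc_map {W' : (Over U)ᵒᵖ} (f : W ⟶ W') (s : (extZeroAb h F).obj W) :
    extZeroDesc h ψ W' ((extZeroAb h F).map f s) = N.map f (extZeroDesc h ψ W s) := by
  by_cases hW : W.unop.left ≤ V
  · have hW' : W'.unop.left ≤ V := (leOfHom f.unop.left).trans hW
    have e₁ := extZeroDesc_of_le h ψ hW s
    have e₂ := extZeroDesc_of_le h ψ hW' ((extZeroAb h F).map f s)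
    have e₃ := extZeroAb_map_of_le h F f hW ⟨hW'⟩ s
    have e₄ := PresheafOfModules.naturality_apply ψ
      (opOverHom hW hW' (leOfHom f.unop.left)) (s ⟨hW⟩)
    refine e₂.trans ((congrArg (ψ.app (opOver hW')) e₃).trans (e₄.trans ?_))
    exact (congrArg (N.map f) e₁).symm
  · have e₁ := extZeroDesc_of_not_le h ψ hW s
    refine .trans ?_ ((congrArg (N.map f) e₁).trans (map_zero (N.map f).hom)).symm
    by_cases hW' : W'.unop.left ≤ V
    · have e₂ := extZeroDesc_of_le h ψ hW' ((extZeroAb h F).map f s)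
      have e₃ := extZeroAb_map_of_not_le h F f hW ⟨hW'⟩ s
      exact e₂.trans ((congrArg (ψ.app (opOver hW')) e₃).trans
        (map_zero (ψ.app (opOver hW')).hom))
    · exact extZeroDesc_of_not_le h ψ hW' ((extZeroAb h F).map f s)

end

/-- Morphisms from an extension by zero are the morphisms to the restriction. -/
def extZeroHomEquiv (A : X.Sheaf RingCat.{u}) {U V : Opens X} (h : V ≤ U)
    (F : PresheafOfModules.{u} (Sheaf.over A V).obj)
    (N : PresheafOfModules.{u} (Sheaf.over A U).obj) :
    ((extZero A h).obj F ⟶ N) ≃ (F ⟶ (presheafRes A h).obj N) where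
  toFun φ := PresheafOfModules.homMk
    { app W := AddCommGrpCat.ofHom (AddMonoidHom.mk'
        (fun s => φ.app ((Over.map (homOfLE h)).op.obj W) (fun _ => s))
        (fun s t => map_add (φ.app ((Over.map (homOfLE h)).op.obj W)).hom _ _))
      naturality W W' f := by
        ext s
        refine .trans ?_ (PresheafOfModules.naturality_apply φ ((Over.map (homOfLE h)).op.map f)
          (fun _ => s))
        refine congrArg (φ.app ((Over.map (homOfLE h)).op.obj W')) (funext fun i => ?_)
        exact ((extZeroAb_map_of_le h F ((Over.map (homOfLE h)).op.map f)
          (leOfHom W.unop.hom) i (fun _ => s)).trans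
            (F.congr_map_apply (Subsingleton.elim _ _) _)).symm }
    (fun W r s => (φ.app ((Over.map (homOfLE h)).op.obj W)).hom.map_smul _ _)
  invFun ψ := PresheafOfModules.homMk
    { app W := AddCommGrpCat.ofHom (AddMonoidHom.mk' (extZeroDesc h ψ W) (extZeroDesc_add h ψ))
      naturality W W' f := by
        ext s
        exact extZeroDesc_map h ψ f s }
    (fun W r s => extZeroDesc_smul h ψ r s)
  left_inv φ := by
    ext W s
    by_cases hW : W.unop.left ≤ V
    · exact extZeroDesc_of_le h _ hW s
    · refine (extZeroDesc_of_not_le h _ hW s).trans ?_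
      have hs : s = 0 := funext fun i => (hW i.down).elim
      rw [hs]
      exact (map_zero (φ.app W).hom).symm
  right_inv ψ := by
    ext W s
    exact extZeroDesc_of_le h ψ (W := (Over.map (homOfLE h)).op.obj W) (leOfHom W.unop.hom)
      (fun _ => s)

/-- Presheaf extension by zero is left adjoint to restriction. -/
def extZeroAdj (A : X.Sheaf RingCat.{u}) {U V : Opens X} (h : V ≤ U) :
    extZero A h ⊣ presheafRes A h :=
  Adjunction.mkOfHomEquiv
    { homEquiv := extZeroHomEquiv A h
      homEquiv_naturality_left_symm := fun {F' F N} f g => by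
        ext W s
        by_cases hW : W.unop.left ≤ V
        · refine (extZeroDesc_of_le h _ hW s).trans ?_
          exact (extZeroDesc_of_le h g hW (((extZero A h).map f).app W s)).symm
        · refine (extZeroDesc_of_not_le h _ hW s).trans ?_
          exact (extZeroDesc_of_not_le h g hW (((extZero A h).map f).app W s)).symm
      homEquiv_naturality_right := fun {F N N'} f g => rfl }

/-- Extension by zero `j_!` of sheaves of modules, for the inclusion `j` of `V` in `U`: the
sheafification of the presheaf extension by zero. -/
def lower (A : X.Sheaf RingCat.{u}) {U V : Opens X} (h : V ≤ U) : ModOn A V ⥤ ModOn A U :=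
  SheafOfModules.forget _ ⋙ extZero A h ⋙ PresheafOfModules.sheafification (𝟙 (Sheaf.over A U).obj)

/-- Extension by zero is left adjoint to restriction. -/
def lowerAdj (A : X.Sheaf RingCat.{u}) {U V : Opens X} (h : V ≤ U) :
    lower A h ⊣ ModOn.res A h :=
  ((extZeroAdj A h).comp (PresheafOfModules.sheafificationAdjunction
    (𝟙 (Sheaf.over A U).obj))).restrictFullyFaithful (SheafOfModules.fullyFaithfulForget _)
      (Functor.FullyFaithful.id _) (Iso.refl _)
      (NatIso.ofComponents fun M => PresheafOfModules.isoMk (fun _ => Iso.refl _))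

end

/-! ### Exactness and locality for sheaves of modules -/

section

variable {X : TopCat.{u}}

section

variable (A : X.Sheaf RingCat.{u}) {U V : Opens X} (h : V ≤ U)

instance : (lower A h).IsLeftAdjoint := (lowerAdj A h).isLeftAdjoint

instance : (lower A h).Additive := (lowerAdj A h).left_adjoint_additive

instance : (lower A h).PreservesMonomorphisms := by
  unfold lower
  infer_instance

/-- A left adjoint which preserves monomorphisms is exact. -/
instance : PreservesFiniteLimits (lower A h) :=
  ((Functor.preservesFiniteLimits_tfae (lower A h)).out 0 3).1 fun S hS => by
    have := hS.mono_f
    have := hS.epi_g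
    refine ⟨?_, inferInstance⟩
    have hc : PreservesFiniteColimits (lower A h) := inferInstance
    exact ((Functor.preservesFiniteColimits_iff_forall_exact_map_and_epi _).1 hc S hS).1

lemma isIso_homMk_over {Y Z : Over V} (f : Y ⟶ Z) (hf : Z.left ≤ Y.left) : IsIso f :=
  ⟨Over.homMk (homOfLE hf), Subsingleton.elim _ _ , Subsingleton.elim _ _⟩

/-- The counit of the adjunction between restriction and direct image is an isomorphism, since
`W ∩ V = W` for `W ≤ V`. -/
instance : IsIso (SheafOfModules.overMapPushforwardAdj.{u} A (homOfLE h)).counit := by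
  rw [NatTrans.isIso_iff_isIso_app]
  intro M
  rw [← isIso_iff_of_reflects_iso _ (SheafOfModules.forget _ ⋙ PresheafOfModules.toPresheaf _),
    NatTrans.isIso_iff_isIso_app]
  intro W
  have : IsIso ((Over.mapPullbackAdj (homOfLE h)).unit.app W.unop) :=
    isIso_homMk_over _ (leOfHom (pullback.fst _ _))
  exact inferInstanceAs
    (IsIso (M.val.presheaf.map ((Over.mapPullbackAdj (homOfLE h)).unit.app W.unop).op))

/-- Restriction has fully faithful adjoints on one side if and only if it has on the other. -/
instance : IsIso (lowerAdj A h).unit :=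
  (Adjunction.Triple.mk (lowerAdj A h)
    (SheafOfModules.overMapPushforwardAdj A (homOfLE h))).isIso_unit_iff_isIso_counit.2
      (inferInstanceAs (IsIso (SheafOfModules.overMapPushforwardAdj.{u} A (homOfLE h)).counit))

lemma ModOn.section_eq_zero_of_isZero_res {F : ModOn A U} (hF : IsZero ((ModOn.res A h).obj F))
    {W : Opens X} (hW : W ≤ V) (s : F.val.obj (opOver (hW.trans h))) : s = 0 := by
  have h0 : (𝟙 ((ModOn.res A h).obj F)) = 0 := (IsZero.iff_id_eq_zero _).1 hF
  have h1 := congrArg (fun f : (ModOn.res A h).obj F ⟶ (ModOn.res A h).obj F =>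
    (f.val.app (opOver hW)).hom s) h0
  exact h1

end

section

variable (A : X.Sheaf RingCat.{u})

lemma ModOn.isZero_of_cover {U : Opens X} {ι : Type*} (V : ι → Opens X) (hV : ∀ i, V i ≤ U)
    (hcov : U ≤ ⨆ i, V i) (F : ModOn A U)
    (hF : ∀ i, IsZero ((ModOn.res A (hV i)).obj F)) : IsZero F := by
  rw [IsZero.iff_id_eq_zero]
  ext W s
  change s = 0
  let S : Sieve W.unop.left :=
    { arrows := fun Y _ => ∃ i, Y ≤ V i
      downward_closed := by
        rintro Y Z f ⟨i, hi⟩ g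
        exact ⟨i, (leOfHom g).trans hi⟩ }
  have hS : (Sieve.overEquiv W.unop).symm S ∈
      ((Opens.grothendieckTopology X).over U) W.unop := by
    apply GrothendieckTopology.overEquiv_symm_mem_over
    intro x hx
    obtain ⟨i, hi⟩ := Opens.mem_iSup.1 (hcov (leOfHom W.unop.hom hx))
    exact ⟨W.unop.left ⊓ V i, homOfLE inf_le_left, ⟨i, inf_le_right⟩, hx, hi⟩
  have hsep := (Presheaf.isSheaf_iff_isSheaf_forget _ F.val.presheaf (forget Ab)).1 F.isSheaf
  refine (((isSheaf_iff_isSheaf_of_type _ _).1 hsep).isSeparated _ hS).ext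
    fun Y f hf => ?_
  obtain ⟨i, hi⟩ := hf
  exact (ModOn.section_eq_zero_of_isZero_res A (hV i) (hF i) hi (F.val.map f.op s)).trans
    (ModOn.section_eq_zero_of_isZero_res A (hV i) (hF i) hi (F.val.map f.op 0)).symm

/-- The extension by zero of `F` from `V₂` vanishes over `V₁` if `F` vanishes over `V₁ ∩ V₂`. By
adjunction this is a statement about morphisms from `F` to the restriction to `V₂` of a direct image
from `V₁`. -/
lemma ModOn.isZero_lower_res {U V₁ V₂ W : Opens X} (h₁ : V₁ ≤ U) (h₂ : V₂ ≤ U) (hW : W ≤ V₂)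
    (hW' : V₁ ⊓ V₂ ≤ W) (F : ModOn A V₂) (hF : IsZero ((ModOn.res A hW).obj F)) :
    IsZero ((ModOn.res A h₁).obj ((lower A h₂).obj F)) := by
  rw [IsZero.iff_id_eq_zero]
  apply ((SheafOfModules.overMapPushforwardAdj A (homOfLE h₁)).homEquiv _ _).injective
  apply ((lowerAdj A h₂).homEquiv _ _).injective
  suffices ∀ (T : ModOn A V₁) (g : F ⟶ (ModOn.res A h₂).obj
      ((SheafOfModules.overPullback A (homOfLE h₁)).obj T)), g = 0 from
    (this _ _).trans (this _ _).symm
  intro T g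
  let G := (ModOn.res A h₂).obj ((SheafOfModules.overPullback A (homOfLE h₁)).obj T)
  ext Y s
  let Y' : (Over V₂)ᵒᵖ := opOver (W := Y.unop.left ⊓ V₁) (inf_le_left.trans (leOfHom Y.unop.hom))
  let f : Y ⟶ Y' := (Over.homMk (U := Y'.unop) (V := Y.unop) (homOfLE inf_le_left)).op
  have hs : F.val.map f s = 0 := ModOn.section_eq_zero_of_isZero_res A hW hF
    (W := Y.unop.left ⊓ V₁)
    ((le_inf inf_le_right (inf_le_left.trans (leOfHom Y.unop.hom))).trans hW') _
  let j : (Over.pullback (homOfLE h₁)).obj ((Over.map (homOfLE h₂)).obj Y'.unop) ⟶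
      (Over.pullback (homOfLE h₁)).obj ((Over.map (homOfLE h₂)).obj Y.unop) :=
    (Over.pullback (homOfLE h₁)).map ((Over.map (homOfLE h₂)).map f.unop)
  -- direct images from `V₁` have the same sections over `Y` and `Y ∩ V₁`
  have hj : IsIso j := isIso_homMk_over j <| leOfHom <|
    pullback.lift (homOfLE (le_inf (leOfHom (pullback.fst _ _)) (leOfHom (pullback.snd _ _))))
      (pullback.snd _ _) (Subsingleton.elim _ _)
  have hinj : Function.Injective (T.val.presheaf.map j.op) :=
    (AddCommGrpCat.mono_iff_injective _).1 inferInstance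
  apply hinj
  have hn : T.val.presheaf.map j.op (g.val.app Y s) = g.val.app Y' (F.val.map f s) :=
    (PresheafOfModules.naturality_apply g.val f s).symm
  refine hn.trans ?_
  rw [hs]
  exact (map_zero (g.val.app Y').hom).trans (map_zero (T.val.presheaf.map j.op).hom).symm

lemma ModOn.resComp_assoc {U V W Z : Opens X} (h : V ≤ U) (hW : W ≤ V) (hZ : Z ≤ W)
    (M : ModOn A U) :
    (ModOn.res A hZ).map ((ModOn.resComp A h hW).hom.app M) ≫
      (ModOn.resComp A (hW.trans h) hZ).hom.app M =
    (ModOn.resComp A hW hZ).hom.app ((ModOn.res A h).obj M) ≫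
      (ModOn.resComp A h (hZ.trans hW)).hom.app M := by
  ext Y s
  rfl

/-- Restriction from `U` to `U` is isomorphic to the identity functor. -/
def ModOn.resSelf (U : Opens X) : ModOn.res A (le_refl U) ≅ 𝟭 _ :=
  NatIso.ofComponents
    fun M => (SheafOfModules.fullyFaithfulForget _).preimageIso <|
      PresheafOfModules.isoMk (fun _ => Iso.refl _)

end

end

/-! ### Extension by zero on derived categories -/

section

section

variable {C D : Type*} [Category* C] [Category* D]

/-- An adjunction between additive functors extends degreewise to complexes. -/
def adjunctionMapHomologicalComplex [Preadditive C] [Preadditive D]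
    {F : C ⥤ D} {G : D ⥤ C} [F.Additive] [G.Additive] (adj : F ⊣ G) {ι : Type*}
    (c : ComplexShape ι) :
    F.mapHomologicalComplex c ⊣ G.mapHomologicalComplex c where
  unit :=
    { app K :=
        { f i := adj.unit.app (K.X i)
          comm' i j _ := (adj.unit.naturality (K.d i j)).symm }
      naturality K L f := by
        ext n : 1
        exact adj.unit.naturality (f.f n) }
  counit :=
    { app K :=
        { f i := adj.counit.app (K.X i)
          comm' i j _ := (adj.counit.naturality (K.d i j)).symm }
      naturality K L f := by
        ext n : 1
        exact adj.counit.naturality (f.f n) }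
  left_triangle_components K := by
    ext n : 1
    exact adj.left_triangle_components (K.X n)
  right_triangle_components K := by
    ext n : 1
    exact adj.right_triangle_components (K.X n)

variable [Abelian C] [Abelian D] [HasDerivedCategory C] [HasDerivedCategory D]

open ZeroObject in
lemma isZero_of_homology {M : DerivedCategory C}
    (hM : ∀ i, IsZero ((DerivedCategory.homologyFunctor C i).obj M)) : IsZero M := by
  have : IsIso (0 : M ⟶ 0) := (DerivedCategory.isIso_iff C _).2 fun i =>
    ⟨0, (hM i).eq_of_src _ _,
      ((DerivedCategory.homologyFunctor C i).map_isZero (isZero_zero _)).eq_of_src _ _⟩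
  exact (isZero_zero _).of_iso (asIso (0 : M ⟶ 0))

section

variable (F : C ⥤ D) [F.Additive] [PreservesFiniteLimits F] [PreservesFiniteColimits F]

/-- An exact functor commutes with the cohomology of objects of the derived category. -/
def homologyMapDerivedCategoryIso (M : DerivedCategory C) (i : ℤ) :
    (DerivedCategory.homologyFunctor D i).obj (F.mapDerivedCategory.obj M) ≅
      F.obj ((DerivedCategory.homologyFunctor C i).obj M) :=
  let K := DerivedCategory.Q.objPreimage M
  let e : DerivedCategory.Q.obj K ≅ M := DerivedCategory.Q.objObjPreimageIso M
  (DerivedCategory.homologyFunctor _ i).mapIso (F.mapDerivedCategory.mapIso e.symm ≪≫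
      F.mapDerivedCategoryFactors.app K) ≪≫
    (DerivedCategory.homologyFunctorFactors _ i).app _ ≪≫
    (K.sc i).mapHomologyIso F ≪≫
    F.mapIso ((DerivedCategory.homologyFunctorFactors _ i).symm.app K ≪≫
      (DerivedCategory.homologyFunctor _ i).mapIso e)

end

section

variable {F : C ⥤ D} [F.Additive] [PreservesFiniteLimits F] [PreservesFiniteColimits F]
  {G : D ⥤ C} [G.Additive] [PreservesFiniteLimits G] [PreservesFiniteColimits G] (adj : F ⊣ G)

/-- Adjoint exact functors induce adjoint functors on the derived categories. -/
def derivedAdjunction : F.mapDerivedCategory ⊣ G.mapDerivedCategory :=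
  letI : CatCommSq (F.mapHomologicalComplex (ComplexShape.up ℤ)) DerivedCategory.Q
    DerivedCategory.Q F.mapDerivedCategory := ⟨F.mapDerivedCategoryFactors.symm⟩
  letI : CatCommSq (G.mapHomologicalComplex (ComplexShape.up ℤ)) DerivedCategory.Q
    DerivedCategory.Q G.mapDerivedCategory := ⟨G.mapDerivedCategoryFactors.symm⟩
  (adjunctionMapHomologicalComplex adj (ComplexShape.up ℤ)).localization
    DerivedCategory.Q (HomologicalComplex.quasiIso _ _) DerivedCategory.Q
    (HomologicalComplex.quasiIso _ _) _ _

instance isIso_derivedAdjunction_unit [IsIso adj.unit] : IsIso (derivedAdjunction adj).unit := by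
  rw [NatTrans.isIso_iff_isIso_app]
  intro M
  suffices IsIso ((derivedAdjunction adj).unit.app
      (DerivedCategory.Q.obj (DerivedCategory.Q.objPreimage M))) by
    rwa [NatTrans.isIso_app_iff_of_iso _ (DerivedCategory.Q.objObjPreimageIso M).symm]
  have h1 (K : CochainComplex C ℤ) : IsIso
      ((adjunctionMapHomologicalComplex adj (ComplexShape.up ℤ)).unit.app K) := by
    have (i : ℤ) : IsIso (((adjunctionMapHomologicalComplex adj
        (ComplexShape.up ℤ)).unit.app K).f i) := inferInstanceAs (IsIso (adj.unit.app (K.X i)))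
    exact HomologicalComplex.Hom.isIso_of_components _
  unfold derivedAdjunction
  rw [Adjunction.localization_unit_app]
  infer_instance

end

end

variable {X : TopCat.{u}} (A : X.Sheaf RingCat.{u})

section

variable {U V : Opens X} (h : V ≤ U)

instance : (res A h).CommShift ℤ := inferInstanceAs ((ModOn.res A h).mapDerivedCategory.CommShift ℤ)

instance : (res A h).IsTriangulated :=
  inferInstanceAs ((ModOn.res A h).mapDerivedCategory.IsTriangulated)

/-- Extension by zero `j_!` on derived categories. -/
def lowerD : D A V ⥤ D A U := (lower A h).mapDerivedCategory

/-- On derived categories, extension by zero is left adjoint to restriction. -/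
def lowerDAdj : lowerD A h ⊣ res A h := derivedAdjunction (lowerAdj A h)

instance : IsIso (lowerDAdj A h).unit := isIso_derivedAdjunction_unit (lowerAdj A h)

lemma isLE_res (M : D A U) (n : ℤ) (hM : M.IsLE n) : ((res A h).obj M).IsLE n :=
  (DerivedCategory.isLE_iff _ _).2 fun i hi =>
    ((ModOn.res A h).map_isZero ((DerivedCategory.isLE_iff _ _).1 hM i hi)).of_iso
      (homologyResIso A h M i)

lemma isGE_res (M : D A U) (n : ℤ) (hM : M.IsGE n) : ((res A h).obj M).IsGE n :=
  (DerivedCategory.isGE_iff _ _).2 fun i hi =>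
    ((ModOn.res A h).map_isZero ((DerivedCategory.isGE_iff _ _).1 hM i hi)).of_iso
      (homologyResIso A h M i)

end

section

variable {U : Opens X} {ι : Type*} (V : ι → Opens X) (hV : ∀ i, V i ≤ U)
    (hcov : U ≤ ⨆ i, V i)

include hcov

/-- An object of the derived category which is locally zero is zero. -/
lemma isZero_of_cover {M : D A U} (hM : ∀ i, IsZero ((res A (hV i)).obj M)) : IsZero M :=
  isZero_of_homology fun n => ModOn.isZero_of_cover A V hV hcov _ fun i =>
    ((DerivedCategory.homologyFunctor _ n).map_isZero (hM i)).of_iso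
      (homologyResIso A (hV i) M n).symm

lemma isIso_of_cover {M N : D A U} (f : M ⟶ N) (hf : ∀ i, IsIso ((res A (hV i)).map f)) :
    IsIso f := by
  obtain ⟨Z, g, k, hT⟩ := Pretriangulated.distinguished_cocone_triangle f
  refine (Pretriangulated.Triangle.isZero₃_iff_isIso₁ _ hT).1 ?_
  refine isZero_of_cover A V hV hcov fun i => ?_
  exact (Pretriangulated.Triangle.isZero₃_iff_isIso₁ _
    ((res A (hV i)).map_distinguished _ hT)).2 (hf i)

lemma isLE_of_cover {M : D A U} (n : ℤ) (hM : ∀ i, ((res A (hV i)).obj M).IsLE n) : M.IsLE n :=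
  (DerivedCategory.isLE_iff _ _).2 fun j hj => ModOn.isZero_of_cover A V hV hcov _ fun i =>
    ((DerivedCategory.isLE_iff _ _).1 (hM i) j hj).of_iso (homologyResIso A (hV i) M j).symm

lemma isGE_of_cover {M : D A U} (n : ℤ) (hM : ∀ i, ((res A (hV i)).obj M).IsGE n) : M.IsGE n :=
  (DerivedCategory.isGE_iff _ _).2 fun j hj => ModOn.isZero_of_cover A V hV hcov _ fun i =>
    ((DerivedCategory.isGE_iff _ _).1 (hM i) j hj).of_iso (homologyResIso A (hV i) M j).symm

end

lemma isZero_lowerD_res {U V₁ V₂ W : Opens X} (h₁ : V₁ ≤ U) (h₂ : V₂ ≤ U) (hW : W ≤ V₂)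
    (hW' : V₁ ⊓ V₂ ≤ W) (M : D A V₂) (hM : IsZero ((res A hW).obj M)) :
    IsZero ((res A h₁).obj ((lowerD A h₂).obj M)) :=
  isZero_of_homology fun n => by
    refine IsZero.of_iso ?_ (homologyResIso A h₁ _ n)
    refine IsZero.of_iso ?_ ((ModOn.res A h₁).mapIso
      (homologyMapDerivedCategoryIso (lower A h₂) M n))
    refine ModOn.isZero_lower_res A h₁ h₂ hW hW' _ ?_
    exact ((DerivedCategory.homologyFunctor _ n).map_isZero hM).of_iso
      (homologyResIso A hW M n).symm

section

variable {U V : Opens X} (h : V ≤ U)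

/-- The restriction functor on complexes of modules. -/
abbrev resCpx : CochainComplex (ModOn A U) ℤ ⥤ CochainComplex (ModOn A V) ℤ :=
  (ModOn.res A h).mapHomologicalComplex (ComplexShape.up ℤ)

/-- Restriction of complexes of modules computes restriction in the derived category. -/
def resQIso : DerivedCategory.Q ⋙ res A h ≅ resCpx A h ⋙ DerivedCategory.Q :=
  (ModOn.res A h).mapDerivedCategoryFactors

/-- The isomorphism `ModOn.resComp` on complexes. -/
def resCpxComp {W : Opens X} (hW : W ≤ V) : resCpx A h ⋙ resCpx A hW ≅ resCpx A (hW.trans h) :=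
  Functor.mapHomologicalComplexCompIso (ModOn.resComp A h hW) (ComplexShape.up ℤ)

lemma resComp_hom_app_Q {W : Opens X} (hW : W ≤ V) (K : CochainComplex (ModOn A U) ℤ) :
    (resComp A h hW).hom.app (DerivedCategory.Q.obj K) =
      (res A hW).map ((resQIso A h).hom.app K) ≫ (resQIso A hW).hom.app ((resCpx A h).obj K) ≫
        DerivedCategory.Q.map ((resCpxComp A h hW).hom.app K) ≫
          (resQIso A (hW.trans h)).inv.app K := by
  let : Localization.Lifting DerivedCategory.Q
      (HomologicalComplex.quasiIso (ModOn A U) (ComplexShape.up ℤ))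
      ((resCpx A h ⋙ resCpx A hW) ⋙ DerivedCategory.Q) (res A h ⋙ res A hW) :=
    ⟨(Functor.associator _ _ _).symm ≪≫
      Functor.isoWhiskerRight (ModOn.res A h).mapDerivedCategoryFactors _ ≪≫
      Functor.associator _ _ _ ≪≫
      Functor.isoWhiskerLeft _ (ModOn.res A hW).mapDerivedCategoryFactors ≪≫
      (Functor.associator _ _ _).symm⟩
  let : Localization.Lifting DerivedCategory.Q
      (HomologicalComplex.quasiIso (ModOn A U) (ComplexShape.up ℤ))
      (resCpx A (hW.trans h) ⋙ DerivedCategory.Q) (res A (hW.trans h)) :=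
    ⟨(ModOn.res A (hW.trans h)).mapDerivedCategoryFactors⟩
  refine (Localization.liftNatTrans_app DerivedCategory.Q
    (HomologicalComplex.quasiIso (ModOn A U) (ComplexShape.up ℤ))
    ((resCpx A h ⋙ resCpx A hW) ⋙ DerivedCategory.Q) (resCpx A (hW.trans h) ⋙ DerivedCategory.Q)
    _ _ _ K).trans ?_
  have e : (Localization.Lifting.iso DerivedCategory.Q
      (HomologicalComplex.quasiIso (ModOn A U) (ComplexShape.up ℤ))
      ((resCpx A h ⋙ resCpx A hW) ⋙ DerivedCategory.Q) (res A h ⋙ res A hW)).hom.app K =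
      (res A hW).map ((resQIso A h).hom.app K) ≫
        (resQIso A hW).hom.app ((resCpx A h).obj K) := by
    change 𝟙 _ ≫ (res A hW).map ((resQIso A h).hom.app K) ≫ 𝟙 _ ≫
      (resQIso A hW).hom.app ((resCpx A h).obj K) ≫ 𝟙 _ = _
    rw [Category.id_comp, Category.id_comp, Category.comp_id]
  rw [e, Category.assoc]
  rfl

lemma resCpxComp_assoc {W Z : Opens X} (hW : W ≤ V) (hZ : Z ≤ W)
    (K : CochainComplex (ModOn A U) ℤ) :
    (resCpx A hZ).map ((resCpxComp A h hW).hom.app K) ≫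
      (resCpxComp A (hW.trans h) hZ).hom.app K =
    (resCpxComp A hW hZ).hom.app ((resCpx A h).obj K) ≫
      (resCpxComp A h (hZ.trans hW)).hom.app K := by
  ext n : 1
  exact ModOn.resComp_assoc A h hW hZ (K.X n)

end

end

/-! ### Calculus of restrictions of morphisms -/

section

/-- Associativity of comparison isomorphisms `d` between localized functors follows from that of the
comparison isomorphisms `c` between the functors which they are induced by. -/
lemma localized_comp_assoc {C₀ C₁ C₂ C₃ D₀ D₁ D₂ D₃ : Type*} [Category* C₀] [Category* C₁]
    [Category* C₂] [Category* C₃] [Category* D₀] [Category* D₁] [Category* D₂] [Category* D₃]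
    {Q₀ : C₀ ⥤ D₀} {Q₁ : C₁ ⥤ D₁} {Q₂ : C₂ ⥤ D₂} {Q₃ : C₃ ⥤ D₃}
    {R₀₁ : C₀ ⥤ C₁} {R₁₂ : C₁ ⥤ C₂} {R₂₃ : C₂ ⥤ C₃} {R₀₂ : C₀ ⥤ C₂} {R₁₃ : C₁ ⥤ C₃}
    {R₀₃ : C₀ ⥤ C₃} {r₀₁ : D₀ ⥤ D₁} {r₁₂ : D₁ ⥤ D₂} {r₂₃ : D₂ ⥤ D₃} {r₀₂ : D₀ ⥤ D₂}
    {r₁₃ : D₁ ⥤ D₃} {r₀₃ : D₀ ⥤ D₃}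
    (φ₀₁ : Q₀ ⋙ r₀₁ ≅ R₀₁ ⋙ Q₁) (φ₁₂ : Q₁ ⋙ r₁₂ ≅ R₁₂ ⋙ Q₂) (φ₂₃ : Q₂ ⋙ r₂₃ ≅ R₂₃ ⋙ Q₃)
    (φ₀₂ : Q₀ ⋙ r₀₂ ≅ R₀₂ ⋙ Q₂) (φ₁₃ : Q₁ ⋙ r₁₃ ≅ R₁₃ ⋙ Q₃) (φ₀₃ : Q₀ ⋙ r₀₃ ≅ R₀₃ ⋙ Q₃)
    (c₀₁₂ : R₀₁ ⋙ R₁₂ ⟶ R₀₂) (c₁₂₃ : R₁₂ ⋙ R₂₃ ⟶ R₁₃) (c₀₂₃ : R₀₂ ⋙ R₂₃ ⟶ R₀₃)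
    (c₀₁₃ : R₀₁ ⋙ R₁₃ ⟶ R₀₃)
    (d₀₁₂ : r₀₁ ⋙ r₁₂ ⟶ r₀₂) (d₁₂₃ : r₁₂ ⋙ r₂₃ ⟶ r₁₃) (d₀₂₃ : r₀₂ ⋙ r₂₃ ⟶ r₀₃)
    (d₀₁₃ : r₀₁ ⋙ r₁₃ ⟶ r₀₃)
    (h₀₁₂ : ∀ K, d₀₁₂.app (Q₀.obj K) = r₁₂.map (φ₀₁.hom.app K) ≫ φ₁₂.hom.app (R₀₁.obj K) ≫
      Q₂.map (c₀₁₂.app K) ≫ φ₀₂.inv.app K)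
    (h₁₂₃ : ∀ K, d₁₂₃.app (Q₁.obj K) = r₂₃.map (φ₁₂.hom.app K) ≫ φ₂₃.hom.app (R₁₂.obj K) ≫
      Q₃.map (c₁₂₃.app K) ≫ φ₁₃.inv.app K)
    (h₀₂₃ : ∀ K, d₀₂₃.app (Q₀.obj K) = r₂₃.map (φ₀₂.hom.app K) ≫ φ₂₃.hom.app (R₀₂.obj K) ≫
      Q₃.map (c₀₂₃.app K) ≫ φ₀₃.inv.app K)
    (h₀₁₃ : ∀ K, d₀₁₃.app (Q₀.obj K) = r₁₃.map (φ₀₁.hom.app K) ≫ φ₁₃.hom.app (R₀₁.obj K) ≫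
      Q₃.map (c₀₁₃.app K) ≫ φ₀₃.inv.app K)
    (hc : ∀ K, R₂₃.map (c₀₁₂.app K) ≫ c₀₂₃.app K = c₁₂₃.app (R₀₁.obj K) ≫ c₀₁₃.app K) (K : C₀) :
    r₂₃.map (d₀₁₂.app (Q₀.obj K)) ≫ d₀₂₃.app (Q₀.obj K) =
      d₁₂₃.app (r₀₁.obj (Q₀.obj K)) ≫ d₀₁₃.app (Q₀.obj K) := by
  have n₁₂₃ := d₁₂₃.naturality (φ₀₁.hom.app K)
  have n₂₃ := φ₂₃.hom.naturality (c₀₁₂.app K)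
  have hcK := congrArg (fun f => Q₃.map f) (hc K)
  dsimp at n₁₂₃ n₂₃ hcK
  simp only [Functor.map_comp] at hcK
  rw [h₀₁₂, h₀₂₃, h₀₁₃, ← reassoc_of% n₁₂₃, h₁₂₃]
  simp only [Functor.map_comp, Category.assoc, Iso.inv_hom_id_app_assoc, Functor.comp_obj]
  rw [← Functor.map_comp_assoc r₂₃ (φ₀₂.inv.app K), Iso.inv_hom_id_app,
    CategoryTheory.Functor.map_id, Category.id_comp, reassoc_of% n₂₃, reassoc_of% hcK]

variable {X : TopCat.{u}} (A : X.Sheaf RingCat.{u})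

section

variable {U V W Z : Opens X} (h : V ≤ U) (hW : W ≤ V) (hZ : Z ≤ W)

lemma resComp_naturality {M N : D A U} (f : M ⟶ N) :
    (res A hW).map ((res A h).map f) ≫ (resComp A h hW).hom.app N =
      (resComp A h hW).hom.app M ≫ (res A (hW.trans h)).map f :=
  (resComp A h hW).hom.naturality f

/-- The cocycle condition for the identifications `resComp`. -/
lemma resComp_assoc (M : D A U) :
    (res A hZ).map ((resComp A h hW).hom.app M) ≫ (resComp A (hW.trans h) hZ).hom.app M =
    (resComp A hW hZ).hom.app ((res A h).obj M) ≫ (resComp A h (hZ.trans hW)).hom.app M := by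
  let α : (res A h ⋙ res A hW) ⋙ res A hZ ⟶ res A (hZ.trans (hW.trans h)) :=
    Functor.whiskerRight (resComp A h hW).hom (res A hZ) ≫ (resComp A (hW.trans h) hZ).hom
  let β : (res A h ⋙ res A hW) ⋙ res A hZ ⟶ res A (hZ.trans (hW.trans h)) :=
    Functor.whiskerLeft (res A h) (resComp A hW hZ).hom ≫ (resComp A h (hZ.trans hW)).hom
  suffices α = β from congr_app this M
  refine Localization.natTrans_ext DerivedCategory.Q
    (HomologicalComplex.quasiIso (ModOn A U) (ComplexShape.up ℤ)) fun K => ?_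
  change (res A hZ).map ((resComp A h hW).hom.app _) ≫ (resComp A (hW.trans h) hZ).hom.app _ =
    (resComp A hW hZ).hom.app ((res A h).obj _) ≫ (resComp A h (hZ.trans hW)).hom.app _
  exact localized_comp_assoc (resQIso A h) (resQIso A hW) (resQIso A hZ) (resQIso A (hW.trans h))
    (resQIso A (hZ.trans hW)) (resQIso A (hZ.trans (hW.trans h)))
    (resCpxComp A h hW).hom (resCpxComp A hW hZ).hom (resCpxComp A (hW.trans h) hZ).hom
    (resCpxComp A h (hZ.trans hW)).hom
    (resComp A h hW).hom (resComp A hW hZ).hom (resComp A (hW.trans h) hZ).hom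
    (resComp A h (hZ.trans hW)).hom
    (resComp_hom_app_Q A h hW) (resComp_hom_app_Q A hW hZ) (resComp_hom_app_Q A _ hZ)
    (resComp_hom_app_Q A h _) (resCpxComp_assoc A h hW hZ) K

/-- Restriction of complexes from `U` to `U` is isomorphic to the identity functor. -/
def resCpxSelfIso (U : Opens X) : resCpx A (le_refl U) ≅ 𝟭 _ :=
  NatIso.mapHomologicalComplex (ModOn.resSelf A U) (ComplexShape.up ℤ) ≪≫
    Functor.mapHomologicalComplexIdIso _ _

/-- Restriction from `U` to `U` is isomorphic to the identity functor. -/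
def resSelfIso (U : Opens X) : res A (le_refl U) ≅ 𝟭 _ :=
  letI : Localization.Lifting DerivedCategory.Q
      (HomologicalComplex.quasiIso (ModOn A U) (ComplexShape.up ℤ))
      (resCpx A (le_refl U) ⋙ DerivedCategory.Q) (res A (le_refl U)) := ⟨resQIso A _⟩
  Localization.liftNatIso DerivedCategory.Q
    (HomologicalComplex.quasiIso (ModOn A U) (ComplexShape.up ℤ))
    (resCpx A (le_refl U) ⋙ DerivedCategory.Q) DerivedCategory.Q _ _
    (Functor.isoWhiskerRight (resCpxSelfIso A U) _ ≪≫ Functor.leftUnitor _)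

instance (U : Opens X) : (res A (le_refl U)).Full := Functor.Full.of_iso (resSelfIso A U).symm
instance (U : Opens X) : (res A (le_refl U)).Faithful :=
  Functor.Faithful.of_iso (resSelfIso A U).symm

/-- The canonical isomorphism `M|_U ≅ M` for `M` over `U`, chosen such that it induces
`resComp A le_rfl le_rfl` over `U`. -/
def selfIso {A : X.Sheaf RingCat.{u}} (M : D A U) : (res A le_rfl).obj M ≅ M :=
  (res A le_rfl).preimageIso ((resComp A le_rfl le_rfl).app M)

lemma res_map_selfIso (M : D A U) :
    (res A h).map (selfIso M).hom = (resComp A le_rfl h).hom.app M := by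
  have e : (res A le_rfl).map (selfIso M).hom = (resComp A le_rfl le_rfl).hom.app M := by
    simp [selfIso]
  have h1 := resComp_assoc A le_rfl le_rfl h M
  rw [← e] at h1
  have h2 := resComp_naturality A le_rfl h (selfIso M).hom
  rw [← cancel_epi ((resComp A le_rfl h).hom.app _), ← h2]
  exact h1

lemma resComp_le_rfl (M : D A U) :
    (resComp A h le_rfl).hom.app M = (selfIso ((res A h).obj M)).hom := by
  apply (res A le_rfl).map_injective
  rw [res_map_selfIso]
  have h1 := resComp_assoc A h le_rfl le_rfl M
  exact (cancel_mono _).1 h1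

lemma selfIso_naturality {M N : D A U} (f : M ⟶ N) :
    (res A le_rfl).map f ≫ (selfIso N).hom = (selfIso M).hom ≫ f := by
  apply (res A le_rfl).map_injective
  rw [Functor.map_comp, Functor.map_comp, res_map_selfIso, res_map_selfIso]
  exact resComp_naturality A le_rfl le_rfl f

end

section

variable {A}
variable {U U' U'' V W Z : Opens X} {M : D A U} {N : D A U'} {P : D A U''}
    {h : V ≤ U} {h' : V ≤ U'} {h'' : V ≤ U''}

lemma resHom_comp (f : (res A h).obj M ⟶ (res A h').obj N)
    (g : (res A h').obj N ⟶ (res A h'').obj P) (hW : W ≤ V) :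
    resHom (f ≫ g) hW = resHom f hW ≫ resHom g hW := by
  simp [resHom]

lemma resHom_id (hW : W ≤ V) : resHom (𝟙 ((res A h).obj M)) hW = 𝟙 _ := by
  simp [resHom]

lemma resHom_le_rfl (f : (res A h).obj M ⟶ (res A h').obj N) : resHom f le_rfl = f := by
  have e : (resComp A h le_rfl).inv.app M = (selfIso ((res A h).obj M)).inv := by
    rw [← cancel_mono ((resComp A h le_rfl).hom.app M), Iso.inv_hom_id_app, resComp_le_rfl,
      Iso.inv_hom_id]
  unfold resHom
  rw [e, resComp_le_rfl, selfIso_naturality]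
  simp

lemma resHom_resHom (f : (res A h).obj M ⟶ (res A h').obj N) (hW : W ≤ V) (hZ : Z ≤ W) :
    resHom (resHom f hW) hZ = resHom f (hZ.trans hW) := by
  unfold resHom
  rw [← cancel_epi ((resComp A h (hZ.trans hW)).hom.app M), Iso.hom_inv_id_app_assoc]
  rw [← cancel_epi ((resComp A hW hZ).hom.app ((res A h).obj M))]
  have e₁ := (reassoc_of% (resComp_naturality A hW hZ f))
    ((resComp A h' (hZ.trans hW)).hom.app N)
  refine .trans ?_ e₁
  rw [← resComp_assoc, ← reassoc_of% (resComp_assoc A h hW hZ M)]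
  simp

lemma resHom_map {M N : D A U} (f : M ⟶ N) (hW : W ≤ V) :
    resHom ((res A h).map f) hW = (res A (hW.trans h)).map f := by
  unfold resHom
  rw [resComp_naturality, Iso.inv_hom_id_app_assoc]

lemma res_map_eq_resHom (f : (res A h).obj M ⟶ (res A h').obj N) (hW : W ≤ V) :
    (res A hW).map f = (resComp A h hW).hom.app M ≫ resHom f hW ≫ (resComp A h' hW).inv.app N := by
  simp [resHom]

lemma resHom_resComp (hW : W ≤ V) (hZ : Z ≤ W) :
    resHom (M := (res A h).obj M) (N := M) (h := hW) (h' := hW.trans h)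
      ((resComp A h hW).hom.app M) hZ = (resComp A h (hZ.trans hW)).hom.app M := by
  unfold resHom
  rw [resComp_assoc, Iso.inv_hom_id_app_assoc]

lemma resHom_resComp_inv (hW : W ≤ V) (hZ : Z ≤ W) :
    resHom (M := M) (N := (res A h).obj M) (h' := hW) (h := hW.trans h)
      ((resComp A h hW).inv.app M) hZ = (resComp A h (hZ.trans hW)).inv.app M := by
  rw [← cancel_mono ((resComp A h (hZ.trans hW)).hom.app M), Iso.inv_hom_id_app,
    ← resHom_resComp (M := M) (h := h) hW hZ, ← resHom_comp, Iso.inv_hom_id_app]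
  exact resHom_id _

lemma resHom_zero (hW : W ≤ V) : resHom (0 : (res A h).obj M ⟶ (res A h').obj N) hW = 0 := by
  simp [resHom]

lemma resHom_sub (f g : (res A h).obj M ⟶ (res A h').obj N) (hW : W ≤ V) :
    resHom (f - g) hW = resHom f hW - resHom g hW := by
  simp [resHom]

instance (f : (res A h).obj M ⟶ (res A h').obj N) [IsIso f] (hW : W ≤ V) : IsIso (resHom f hW) := by
  unfold resHom
  infer_instance

end

end

/-! ### The triangle of two open sets -/

section

section

open Pretriangulated

variable {C : Type*} [Category* C] [HasZeroObject C] [HasShift C ℤ] [Preadditive C]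
    [∀ n : ℤ, (shiftFunctor C n).Additive] [Pretriangulated C]

/-- In a distinguished triangle `A ⟶ B ⊕ B' ⟶ N ⟶ A⟦1⟧` (with `S = B ⊕ B'`) in which `A ⟶ B'` is an
isomorphism, `B ⟶ N` is an isomorphism. -/
lemma isIso_of_distTriang_of_isIso {A S N B B' : C} {u : A ⟶ S} {v : S ⟶ N} {w : N ⟶ A⟦(1 : ℤ)⟧}
    (hT : Triangle.mk u v w ∈ distTriang C) (i : B ⟶ S) (p : S ⟶ B) (i' : B' ⟶ S) (p' : S ⟶ B')
    (hip : i ≫ p = 𝟙 B) (hip' : i ≫ p' = 0) (hS : p ≫ i + p' ≫ i' = 𝟙 S) [IsIso (u ≫ p')] :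
    IsIso (i ≫ v) := by
  let r := inv (u ≫ p')
  have hr : u ≫ p' ≫ r = 𝟙 A := by rw [← Category.assoc, IsIso.hom_inv_id]
  have hw : w = 0 := by
    have h1 : w ≫ u⟦(1 : ℤ)⟧' = 0 := comp_distTriang_mor_zero₃₁ _ hT
    have h2 : w ≫ (u ≫ p' ≫ r)⟦(1 : ℤ)⟧' = 0 := by
      rw [Functor.map_comp, reassoc_of% h1, zero_comp]
    rw [hr] at h2
    simpa using h2
  have huv : u ≫ v = 0 := comp_distTriang_mor_zero₁₂ _ hT
  obtain ⟨s, hs⟩ : ∃ s : N ⟶ B, p - p' ≫ r ≫ u ≫ p = v ≫ s := Triangle.yoneda_exact₂ _ hT _ (by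
    change u ≫ (p - p' ≫ r ≫ u ≫ p) = 0
    rw [Preadditive.comp_sub, reassoc_of% hr, sub_self])
  refine ⟨s, ?_, ?_⟩
  · rw [Category.assoc, ← hs, Preadditive.comp_sub, hip, reassoc_of% hip', zero_comp, sub_zero]
  · obtain ⟨x, hx⟩ : ∃ x : A⟦(1 : ℤ)⟧ ⟶ N, s ≫ i ≫ v - 𝟙 N = w ≫ x :=
      Triangle.yoneda_exact₃ _ hT _ (by
      change v ≫ (s ≫ i ≫ v - 𝟙 N) = 0
      have e1 : p ≫ i = 𝟙 S - p' ≫ i' := eq_sub_of_add_eq hS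
      rw [Preadditive.comp_sub, ← Category.assoc, ← hs]
      have e2 : (p - p' ≫ r ≫ u ≫ p) ≫ i ≫ v = v := by
        simp only [Preadditive.sub_comp, Category.assoc]
        rw [reassoc_of% e1]
        simp only [Preadditive.sub_comp, Preadditive.comp_sub, Category.assoc, Category.id_comp,
          huv]
        have e3 : r ≫ u ≫ p' ≫ i' ≫ v = i' ≫ v := by
          have : r ≫ u ≫ p' = 𝟙 B' := IsIso.inv_hom_id _
          rw [reassoc_of% this]
        simp [e3]
      rw [e2, Category.comp_id, sub_self])
    rw [hw, zero_comp, sub_eq_zero] at hx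
    exact hx

section

variable {E : Type*} [Category* E] [HasZeroObject E] [HasShift E ℤ] [Preadditive E]
    [∀ n : ℤ, (shiftFunctor E n).Additive] [Pretriangulated E] (F : C ⥤ E) [F.CommShift ℤ]
    [F.IsTriangulated] [F.Additive] {A B B' N : C} {a : A ⟶ B} {b : A ⟶ B'}
    {v : B ⊞ B' ⟶ N} {w : N ⟶ A⟦(1 : ℤ)⟧}
    (hT : Triangle.mk (biprod.lift a b) v w ∈ distTriang C)

include hT

/-- If `F` inverts `b : A ⟶ B'`, then `F` inverts the morphism from `B` to the cone of
`(a, b) : A ⟶ B ⊕ B'`. -/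
lemma isIso_map_inl_comp [IsIso (F.map b)] : IsIso (F.map (biprod.inl ≫ v)) := by
  have hT' : Triangle.mk (F.map (biprod.lift a b)) (F.map v)
      (F.map w ≫ (F.commShiftIso 1).hom.app A) ∈ distTriang E := F.map_distinguished _ hT
  have : IsIso (F.map (biprod.lift a b) ≫ F.map biprod.snd) := by
    rwa [← F.map_comp, biprod.lift_snd]
  rw [F.map_comp]
  exact isIso_of_distTriang_of_isIso hT' (F.map biprod.inl) (F.map biprod.fst)
    (F.map biprod.inr) (F.map biprod.snd)
    (by rw [← F.map_comp, biprod.inl_fst, F.map_id])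
    (by rw [← F.map_comp, biprod.inl_snd, F.map_zero])
    (by rw [← F.map_comp, ← F.map_comp, ← F.map_add, biprod.total, F.map_id])

lemma isIso_map_inr_comp [IsIso (F.map a)] : IsIso (F.map (biprod.inr ≫ v)) := by
  have hT' : Triangle.mk (F.map (biprod.lift a b)) (F.map v)
      (F.map w ≫ (F.commShiftIso 1).hom.app A) ∈ distTriang E := F.map_distinguished _ hT
  have : IsIso (F.map (biprod.lift a b) ≫ F.map biprod.fst) := by
    rwa [← F.map_comp, biprod.lift_fst]
  rw [F.map_comp]
  exact isIso_of_distTriang_of_isIso hT' (F.map biprod.inr) (F.map biprod.snd)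
    (F.map biprod.inl) (F.map biprod.fst)
    (by rw [← F.map_comp, biprod.inr_snd, F.map_id])
    (by rw [← F.map_comp, biprod.inr_fst, F.map_zero])
    (by rw [← F.map_comp, ← F.map_comp, ← F.map_add, add_comm, biprod.total, F.map_id])

end

omit [HasZeroObject C] [∀ n : ℤ, (shiftFunctor C n).Additive] [Pretriangulated C] in
lemma hom_shift_one_eq_zero {M N : C} (hMN : ∀ f : M ⟶ N⟦(-1 : ℤ)⟧, f = 0) (f : M⟦(1 : ℤ)⟧ ⟶ N) :
    f = 0 := by
  apply ((shiftEquiv C (1 : ℤ)).toAdjunction.homEquiv _ _).injective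
  exact (hMN _).trans (hMN _).symm

end

open Pretriangulated

variable {X : TopCat.{u}} (A : X.Sheaf RingCat.{u})

section

variable {U V : Opens X} (h : V ≤ U)

variable {A} in
lemma isZero_res_shift {M : D A U} (hM : IsZero ((res A h).obj M)) (n : ℤ) :
    IsZero ((res A h).obj (M⟦n⟧)) :=
  ((shiftFunctor (D A V) n).map_isZero hM).of_iso (((res A h).commShiftIso n).app M)

variable {A} in
lemma isZero_res_res {M : D A U} {W : Opens X} (hW : W ≤ V)
    (hM : IsZero ((res A (hW.trans h)).obj M)) : IsZero ((res A hW).obj ((res A h).obj M)) :=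
  hM.of_iso ((resComp A h hW).app M)

variable {A} in
lemma isZero_res_of_le {M : D A U} {W : Opens X} (hW : W ≤ V)
    (hM : IsZero ((res A h).obj M)) : IsZero ((res A (hW.trans h)).obj M) :=
  ((res A hW).map_isZero hM).of_iso ((resComp A h hW).symm.app M)

variable {A h} in
lemma hom_lowerD_eq_zero {M : D A V} {T : D A U} (hT : IsZero ((res A h).obj T))
    (f : (lowerD A h).obj M ⟶ T) : f = 0 :=
  ((lowerDAdj A h).homEquiv _ _).injective (hT.eq_of_tgt _ _)

variable {A h} in
lemma hom_lowerD_shift_eq_zero {M : D A V} {T : D A U} (hT : IsZero ((res A h).obj T))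
    (f : ((lowerD A h).obj M)⟦(1 : ℤ)⟧ ⟶ T) : f = 0 :=
  hom_shift_one_eq_zero (fun _ => hom_lowerD_eq_zero (isZero_res_shift h hT (-1)) _) f

/-- As the unit is an isomorphism, so is the restriction of the counit. -/
instance (M : D A U) : IsIso ((res A h).map ((lowerDAdj A h).counit.app M)) := by
  have : (lowerDAdj A h).unit.app ((res A h).obj M) ≫
      (res A h).map ((lowerDAdj A h).counit.app M) = 𝟙 _ :=
    (lowerDAdj A h).right_triangle_components M
  exact IsIso.of_isIso_fac_left this

variable {W : Opens X} (hW : W ≤ V)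

/-- For `W ≤ V ≤ U`, the canonical morphism from the extension by zero of `M|_W` to the extension by
zero of `M`. -/
def lowerRes (M : D A V) :
    (lowerD A (hW.trans h)).obj ((res A hW).obj M) ⟶ (lowerD A h).obj M :=
  ((lowerDAdj A (hW.trans h)).homEquiv _ _).symm
    ((res A hW).map ((lowerDAdj A h).unit.app M) ≫ (resComp A h hW).hom.app _)

lemma homEquiv_lowerRes_comp (M : D A V) {T : D A U} (g : (lowerD A h).obj M ⟶ T) :
    (lowerDAdj A (hW.trans h)).homEquiv _ _ (lowerRes A h hW M ≫ g) =
      (res A hW).map ((lowerDAdj A h).homEquiv _ _ g) ≫ (resComp A h hW).hom.app T := by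
  rw [Adjunction.homEquiv_naturality_right, lowerRes, Equiv.apply_symm_apply, Category.assoc,
    ← resComp_naturality, Adjunction.homEquiv_unit, Functor.map_comp, Category.assoc]

end

section

variable {U V₁ V₂ W : Opens X} (h₁ : V₁ ≤ U) (h₂ : V₂ ≤ U)

/-- Base change for extension by zero: over `V₁`, the extension by zero of `M` from `V₂` is the
extension by zero of its restriction to `V₁ ∩ V₂`. -/
lemma isIso_res_map_lowerRes (hW : W ≤ V₂) (hinf : V₁ ⊓ V₂ ≤ W) (M : D A V₂) :
    IsIso ((res A h₁).map (lowerRes A h₂ hW M)) := by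
  -- both sides restrict to `M|_W` over `W`
  have hL : IsIso ((res A (hW.trans h₂)).map (lowerRes A h₂ hW M)) := by
    have e := homEquiv_lowerRes_comp A h₂ hW M (𝟙 _)
    rw [Adjunction.homEquiv_id, Category.comp_id, Adjunction.homEquiv_unit] at e
    have : IsIso ((res A hW).map ((lowerDAdj A h₂).unit.app M) ≫ (resComp A h₂ hW).hom.app _) :=
      inferInstance
    exact IsIso.of_isIso_fac_left e
  obtain ⟨Y, v, w, hT⟩ := distinguished_cocone_triangle (lowerRes A h₂ hW M)
  have hYW : IsZero ((res A (hW.trans h₂)).obj Y) :=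
    (Triangle.isZero₃_iff_isIso₁ _ ((res A (hW.trans h₂)).map_distinguished _ hT)).2 hL
  refine (Triangle.isZero₃_iff_isIso₁ _ ((res A h₁).map_distinguished _ hT)).1 ?_
  change IsZero ((res A h₁).obj Y)
  -- the cone `Y` is the extension by zero of `Y|_{V₂}`, as there are no nonzero morphisms from the
  -- extensions by zero to the cone of the counit
  have hε : IsIso ((lowerDAdj A h₂).counit.app Y) := by
    obtain ⟨T, g, k, hT'⟩ := distinguished_cocone_triangle ((lowerDAdj A h₂).counit.app Y)
    refine (Triangle.isZero₃_iff_isIso₁ _ hT').1 ?_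
    change IsZero T
    have hT₂ : IsZero ((res A h₂).obj T) :=
      (Triangle.isZero₃_iff_isIso₁ _ ((res A h₂).map_distinguished _ hT')).2
        (inferInstanceAs (IsIso ((res A h₂).map ((lowerDAdj A h₂).counit.app Y))))
    have hg : g = 0 := by
      obtain ⟨x, hx⟩ := Triangle.yoneda_exact₃ _ hT g (hom_lowerD_eq_zero hT₂ _)
      rw [hx, hom_lowerD_shift_eq_zero (isZero_res_of_le h₂ hW hT₂) x]
      exact comp_zero
    obtain ⟨x, hx⟩ := Triangle.yoneda_exact₃ _ hT' (𝟙 T) ((Category.comp_id _).trans hg)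
    rw [IsZero.iff_id_eq_zero]
    refine hx.trans ?_
    rw [hom_lowerD_shift_eq_zero hT₂ x]
    exact comp_zero
  exact (isZero_lowerD_res A h₁ h₂ hW hinf _ (isZero_res_res h₂ hW hYW)).of_iso
    ((res A h₁).mapIso (asIso ((lowerDAdj A h₂).counit.app Y)).symm)

variable {A} in
/-- The cone of the morphism from the extension by zero of an object on `W = V₁ ∩ V₂`
to the direct sum of the extensions by zero of objects on `V₁` and `V₂`, with its restrictions and
its exactness properties. -/
lemma exists_cone (hW₁ : W ≤ V₁) (hW₂ : W ≤ V₂) (hinf : V₁ ⊓ V₂ ≤ W) {M₁ : D A V₁} {M₂ : D A V₂}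
    (θ : (res A hW₁).obj M₁ ≅ (res A hW₂).obj M₂) :
    ∃ (N : D A U) (p₁ : (lowerD A h₁).obj M₁ ⟶ N) (p₂ : (lowerD A h₂).obj M₂ ⟶ N)
      (w : N ⟶ ((lowerD A (hW₁.trans h₁)).obj ((res A hW₁).obj M₁))⟦(1 : ℤ)⟧),
      lowerRes A h₁ hW₁ M₁ ≫ p₁ = (lowerD A _).map θ.hom ≫ lowerRes A h₂ hW₂ M₂ ≫ p₂ ∧
      IsIso ((res A h₁).map p₁) ∧ IsIso ((res A h₂).map p₂) ∧
      (∀ (T : D A U) (g₁ : (lowerD A h₁).obj M₁ ⟶ T) (g₂ : (lowerD A h₂).obj M₂ ⟶ T),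
        lowerRes A h₁ hW₁ M₁ ≫ g₁ = (lowerD A _).map θ.hom ≫ lowerRes A h₂ hW₂ M₂ ≫ g₂ →
          ∃ n : N ⟶ T, p₁ ≫ n = g₁ ∧ p₂ ≫ n = g₂) ∧
      ∀ (T : D A U) (n : N ⟶ T), p₁ ≫ n = 0 → p₂ ≫ n = 0 → ∃ x, n = w ≫ x := by
  let a := lowerRes A h₁ hW₁ M₁
  let b := (lowerD A (hW₁.trans h₁)).map θ.hom ≫ lowerRes A h₂ hW₂ M₂
  obtain ⟨N, v, w, hT⟩ := distinguished_cocone_triangle (biprod.lift a (-b))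
  have huv : biprod.lift a (-b) ≫ v = 0 := comp_distTriang_mor_zero₁₂ _ hT
  refine ⟨N, biprod.inl ≫ v, biprod.inr ≫ v, w, ?_, ?_, ?_, ?_, ?_⟩
  · have e : a ≫ biprod.inl ≫ v - b ≫ biprod.inr ≫ v = 0 := by
      rw [← huv]
      simp [biprod.lift_eq, sub_eq_add_neg]
    simpa [b] using sub_eq_zero.1 e
  · have := isIso_res_map_lowerRes A h₁ h₂ hW₂ hinf M₂
    have hb : IsIso ((res A h₁).map b) := by
      rw [Functor.map_comp]
      infer_instance
    have : IsIso ((res A h₁).map (-b)) := by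
      rw [Functor.map_neg]
      exact ⟨-inv ((res A h₁).map b), by simp, by simp⟩
    exact isIso_map_inl_comp _ hT
  · have : IsIso ((res A h₂).map a) :=
      isIso_res_map_lowerRes A h₂ h₁ hW₁ (by rwa [inf_comm]) M₁
    exact isIso_map_inr_comp _ hT
  · intro T g₁ g₂ hg
    obtain ⟨n, hn⟩ : ∃ n : N ⟶ T, biprod.desc g₁ g₂ = v ≫ n := Triangle.yoneda_exact₂ _ hT _ (by
      change biprod.lift a (-b) ≫ biprod.desc g₁ g₂ = 0
      rw [biprod.lift_desc, Preadditive.neg_comp, ← sub_eq_add_neg, sub_eq_zero]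
      simpa [b] using hg)
    refine ⟨n, ?_, ?_⟩
    · rw [Category.assoc, ← hn, biprod.inl_desc]
    · rw [Category.assoc, ← hn, biprod.inr_desc]
  · intro T n h1 h2
    exact Triangle.yoneda_exact₃ _ hT n (by
      change v ≫ n = 0
      ext
      · simpa using h1
      · simpa using h2)

end

end

/-! ### Gluing along two open sets -/

section

variable {X : TopCat.{u}} {A : X.Sheaf RingCat.{u}}

section

variable {U V₁ V₂ W : Opens X} (h₁ : V₁ ≤ U) (h₂ : V₂ ≤ U) (hW₁ : W ≤ V₁) (hW₂ : W ≤ V₂)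
  (hinf : V₁ ⊓ V₂ ≤ W)

include hinf

/-- Objects over two open sets can be glued along an isomorphism over their intersection. -/
lemma exists_glue {M₁ : D A V₁} {M₂ : D A V₂} (θ : (res A hW₁).obj M₁ ≅ (res A hW₂).obj M₂) :
    ∃ (N : D A U) (α₁ : (res A h₁).obj N ≅ M₁) (α₂ : (res A h₂).obj N ≅ M₂),
      (resComp A h₁ hW₁).inv.app N ≫ (res A hW₁).map α₁.hom ≫ θ.hom =
        (resComp A h₂ hW₂).inv.app N ≫ (res A hW₂).map α₂.hom := by
  obtain ⟨N, p₁, p₂, -, hp, _, _, -, -⟩ := exists_cone h₁ h₂ hW₁ hW₂ hinf θ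
  let β₁ := (lowerDAdj A h₁).homEquiv _ _ p₁
  let β₂ := (lowerDAdj A h₂).homEquiv _ _ p₂
  have hβ₁ : IsIso β₁ := by
    dsimp only [β₁]; rw [Adjunction.homEquiv_unit]; infer_instance
  have hβ₂ : IsIso β₂ := by
    dsimp only [β₂]; rw [Adjunction.homEquiv_unit]; infer_instance
  have e := congrArg ((lowerDAdj A (hW₁.trans h₁)).homEquiv _ _) hp
  rw [Adjunction.homEquiv_naturality_left] at e
  have e₁ := homEquiv_lowerRes_comp A h₁ hW₁ M₁ p₁
  have e₂ := homEquiv_lowerRes_comp A h₂ hW₂ M₂ p₂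
  have e' : (res A hW₁).map β₁ ≫ (resComp A h₁ hW₁).hom.app N =
      θ.hom ≫ (res A hW₂).map β₂ ≫ (resComp A h₂ hW₂).hom.app N :=
    e₁.symm.trans (e.trans (congrArg (fun f => θ.hom ≫ f) e₂))
  refine ⟨N, (asIso β₁).symm, (asIso β₂).symm, ?_⟩
  rw [← cancel_mono ((res A hW₂).map β₂ ≫ (resComp A h₂ hW₂).hom.app N)]
  simp only [Category.assoc]
  rw [← e']
  simp only [Iso.symm_hom, asIso_inv]
  rw [← Functor.map_comp_assoc, ← Functor.map_comp_assoc, IsIso.inv_hom_id, IsIso.inv_hom_id,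
    CategoryTheory.Functor.map_id, CategoryTheory.Functor.map_id, Category.id_comp,
    Category.id_comp, Iso.inv_hom_id_app, Iso.inv_hom_id_app]

/-- The Mayer-Vietoris triangle of `M` for a covering of `U` by two open sets, through its two
exactness properties: morphisms from `M` can be glued, and locally zero morphisms factor through the
connecting morphism. -/
lemma exists_mayerVietoris (hcov : U ≤ V₁ ⊔ V₂) (M : D A U) :
    ∃ w : M ⟶ ((lowerD A (hW₁.trans h₁)).obj ((res A hW₁).obj ((res A h₁).obj M)))⟦(1 : ℤ)⟧,
      (∀ (T : D A U) (f₁ : (res A h₁).obj M ⟶ (res A h₁).obj T)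
        (f₂ : (res A h₂).obj M ⟶ (res A h₂).obj T), resHom f₁ hW₁ = resHom f₂ hW₂ →
        ∃ f : M ⟶ T, (res A h₁).map f = f₁ ∧ (res A h₂).map f = f₂) ∧
      ∀ (T : D A U) (f : M ⟶ T), (res A h₁).map f = 0 → (res A h₂).map f = 0 →
        ∃ x, f = w ≫ x := by
  let θ : (res A hW₁).obj ((res A h₁).obj M) ≅ (res A hW₂).obj ((res A h₂).obj M) :=
    (resComp A h₁ hW₁).app M ≪≫ ((resComp A h₂ hW₂).app M).symm
  have hθ : θ.hom ≫ (resComp A h₂ hW₂).hom.app M = (resComp A h₁ hW₁).hom.app M := by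
    simp [θ]
  obtain ⟨N, p₁, p₂, w, hp, _, _, hex, hun⟩ := exists_cone h₁ h₂ hW₁ hW₂ hinf θ
  have key (T : D A U) (f₁ : (res A h₁).obj M ⟶ (res A h₁).obj T)
      (f₂ : (res A h₂).obj M ⟶ (res A h₂).obj T) (hf : resHom f₁ hW₁ = resHom f₂ hW₂) :
      ∃ n : N ⟶ T, p₁ ≫ n = ((lowerDAdj A h₁).homEquiv _ _).symm f₁ ∧
        p₂ ≫ n = ((lowerDAdj A h₂).homEquiv _ _).symm f₂ := by
    refine hex T _ _ (((lowerDAdj A (hW₁.trans h₁)).homEquiv _ _).injective ?_)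
    rw [Adjunction.homEquiv_naturality_left]
    refine (homEquiv_lowerRes_comp A h₁ hW₁ _ _).trans
      (Eq.trans ?_ (congrArg (fun f => θ.hom ≫ f) (homEquiv_lowerRes_comp A h₂ hW₂ _ _)).symm)
    rw [Equiv.apply_symm_apply, Equiv.apply_symm_apply]
    calc _ = (resComp A h₁ hW₁).hom.app M ≫ resHom f₁ hW₁ := by
          simp [resHom]
      _ = (resComp A h₁ hW₁).hom.app M ≫ resHom f₂ hW₂ := congrArg _ hf
      _ = _ := by simp [resHom, θ]
  have hc {V : Opens X} (h : V ≤ U) : ((lowerDAdj A h).homEquiv _ _).symm (𝟙 ((res A h).obj M)) =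
      (lowerDAdj A h).counit.app M := Adjunction.homEquiv_symm_id _ _
  obtain ⟨n, hn₁, hn₂⟩ := key M (𝟙 _) (𝟙 _) ((resHom_id _).trans (resHom_id _).symm)
  rw [hc] at hn₁ hn₂
  -- the cone is `M`, as it is so over `V₁` and over `V₂`
  have hn : IsIso n := by
    refine isIso_of_cover A (fun b : Bool => cond b V₁ V₂) (fun b => by cases b <;> assumption)
      (by rwa [iSup_bool_eq]) n fun b => ?_
    cases b
    · have : IsIso ((res A h₂).map p₂ ≫ (res A h₂).map n) := by
        rw [← Functor.map_comp, hn₂]; infer_instance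
      exact IsIso.of_isIso_comp_left ((res A h₂).map p₂) _
    · have : IsIso ((res A h₁).map p₁ ≫ (res A h₁).map n) := by
        rw [← Functor.map_comp, hn₁]; infer_instance
      exact IsIso.of_isIso_comp_left ((res A h₁).map p₁) _
  refine ⟨inv n ≫ w, fun T f₁ f₂ hf => ?_, fun T f hf₁ hf₂ => ?_⟩
  · obtain ⟨m, hm₁, hm₂⟩ := key T f₁ f₂ hf
    have key₂ {V : Opens X} (h : V ≤ U) (p : (lowerD A h).obj ((res A h).obj M) ⟶ N)
        (hp : p ≫ n = (lowerDAdj A h).counit.app M) (g : (res A h).obj M ⟶ (res A h).obj T)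
        (hg : p ≫ m = ((lowerDAdj A h).homEquiv _ _).symm g) :
        (res A h).map (inv n ≫ m) = g := by
      apply ((lowerDAdj A h).homEquiv _ _).symm.injective
      rw [← hg, Adjunction.homEquiv_counit, Adjunction.counit_naturality, ← hp]
      simp
    exact ⟨inv n ≫ m, key₂ h₁ p₁ hn₁ f₁ hm₁, key₂ h₂ p₂ hn₂ f₂ hm₂⟩
  · have key₃ {V : Opens X} (h : V ≤ U) (hf : (res A h).map f = 0) :
        (lowerDAdj A h).counit.app M ≫ f = 0 := by
      have := (lowerDAdj A h).left_adjoint_additive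
      refine ((lowerDAdj A h).counit_naturality f).symm.trans ?_
      rw [hf, Functor.map_zero, zero_comp]
    obtain ⟨x, hx⟩ := hun T (n ≫ f) (by rw [reassoc_of% hn₁, key₃ h₁ hf₁])
      (by rw [reassoc_of% hn₂, key₃ h₂ hf₂])
    exact ⟨x, by rw [Category.assoc, ← hx, IsIso.inv_hom_id_assoc]⟩

variable (hcov : U ≤ V₁ ⊔ V₂) {M T : D A U}
include hcov hW₂

/-- Morphisms over two open sets which agree over the intersection can be glued. -/
lemma exists_map_eq (f₁ : (res A h₁).obj M ⟶ (res A h₁).obj T)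
    (f₂ : (res A h₂).obj M ⟶ (res A h₂).obj T) (hf : resHom f₁ hW₁ = resHom f₂ hW₂) :
    ∃ f : M ⟶ T, (res A h₁).map f = f₁ ∧ (res A h₂).map f = f₂ := by
  obtain ⟨w, hw, -⟩ := exists_mayerVietoris h₁ h₂ hW₁ hW₂ hinf hcov M
  exact hw T f₁ f₂ hf

/-- The gluing of morphisms over two open sets is unique, provided that over the intersection there
are no morphisms of degree `-1`. -/
lemma eq_zero_of_res (hMT : ∀ g : (res A (hW₁.trans h₁)).obj M ⟶
      (res A (hW₁.trans h₁)).obj (T⟦(-1 : ℤ)⟧), g = 0)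
    (f : M ⟶ T) (hf₁ : (res A h₁).map f = 0) (hf₂ : (res A h₂).map f = 0) : f = 0 := by
  obtain ⟨w, -, hw⟩ := exists_mayerVietoris h₁ h₂ hW₁ hW₂ hinf hcov M
  obtain ⟨x, rfl⟩ := hw T f hf₁ hf₂
  suffices x = 0 by rw [this, comp_zero]
  refine hom_shift_one_eq_zero (fun g => ?_) x
  apply ((lowerDAdj A (hW₁.trans h₁)).homEquiv _ _).injective
  rw [← cancel_epi ((resComp A h₁ hW₁).inv.app M)]
  exact (hMT _).trans (hMT _).symm

end

end

/-! ### Descent for morphisms -/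

section

lemma exists_finset_le_sup {X : Type*} [TopologicalSpace X] [NoetherianSpace X] {ι : Type*}
    (V : ι → Opens X) {W : Opens X} (hW : W ≤ ⨆ i, V i) : ∃ s : Finset ι, W ≤ s.sup V := by
  obtain ⟨s, hs⟩ := (NoetherianSpace.isCompact (W : Set X)).elim_finite_subcover
    (fun i => (V i : Set X)) (fun i => (V i).isOpen) (by simpa using SetLike.coe_subset_coe.2 hW)
  refine ⟨s, fun x hx => ?_⟩
  obtain ⟨i, hi, hxi⟩ := Set.mem_iUnion₂.1 (hs hx)
  exact (Finset.le_sup (f := V) hi : V i ≤ s.sup V) hxi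

lemma finset_sup_le_iSup {α ι : Type*} [CompleteLattice α] (V : ι → α) (s : Finset ι) :
    s.sup V ≤ ⨆ i : s, V i :=
  Finset.sup_le fun i hi => le_iSup (fun i : s => V i) ⟨i, hi⟩

variable {X : TopCat.{u}} {A : X.Sheaf RingCat.{u}}

/-- All morphisms from restrictions of `M` to restrictions of `N` vanish. -/
def HomVanishes {U U' : Opens X} (M : D A U) (N : D A U') : Prop :=
  ∀ (W : Opens X) (h : W ≤ U) (h' : W ≤ U') (f : (res A h).obj M ⟶ (res A h').obj N), f = 0

lemma isZero_of_le_bot {W : Opens X} (hW : W ≤ ⊥) (M : D A W) : IsZero M :=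
  isZero_of_cover A (fun i : Empty => i.elim) (fun i => i.elim) (hW.trans bot_le)
    (fun i => i.elim)

variable {U U' V : Opens X} {M : D A U} {N : D A U'} {h : V ≤ U} {h' : V ≤ U'}

lemma HomVanishes.res_res (hMN : HomVanishes M N) {W : Opens X} (hW : W ≤ V)
    (f : (res A hW).obj ((res A h).obj M) ⟶ (res A hW).obj ((res A h').obj N)) : f = 0 := by
  rw [← cancel_epi ((resComp A h hW).inv.app M), ← cancel_mono ((resComp A h' hW).hom.app N)]
  exact (hMN _ _ _ _).trans (hMN _ _ _ _).symm

lemma res_map_eq_zero_of_resHom {W : Opens X} (hW : W ≤ V)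
    {f : (res A h).obj M ⟶ (res A h').obj N} (hf : resHom f hW = 0) : (res A hW).map f = 0 := by
  rw [res_map_eq_resHom, hf, zero_comp, comp_zero]

lemma eq_zero_of_resHom {V₁ V₂ : Opens X} (h₁ : V₁ ≤ V) (h₂ : V₂ ≤ V) (hcov : V ≤ V₁ ⊔ V₂)
    (hMN : HomVanishes M (N⟦(-1 : ℤ)⟧)) (f : (res A h).obj M ⟶ (res A h').obj N)
    (hf₁ : resHom f h₁ = 0) (hf₂ : resHom f h₂ = 0) : f = 0 := by
  refine eq_zero_of_res h₁ h₂ (inf_le_left : V₁ ⊓ V₂ ≤ V₁) inf_le_right le_rfl hcov (fun g => ?_) f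
    (res_map_eq_zero_of_resHom h₁ hf₁) (res_map_eq_zero_of_resHom h₂ hf₂)
  rw [← cancel_mono ((res A (inf_le_left.trans h₁ : V₁ ⊓ V₂ ≤ V)).map
    (((res A h').commShiftIso (-1 : ℤ)).inv.app N))]
  exact (hMN.res_res _ _).trans (hMN.res_res _ _).symm

lemma exists_resHom_eq {V₁ V₂ W : Opens X} (h₁ : V₁ ≤ V) (h₂ : V₂ ≤ V) (hcov : V ≤ V₁ ⊔ V₂)
    (hW₁ : W ≤ V₁) (hW₂ : W ≤ V₂) (hinf : V₁ ⊓ V₂ ≤ W)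
    (f₁ : (res A (h₁.trans h)).obj M ⟶ (res A (h₁.trans h')).obj N)
    (f₂ : (res A (h₂.trans h)).obj M ⟶ (res A (h₂.trans h')).obj N)
    (hf : resHom f₁ hW₁ = resHom f₂ hW₂) :
    ∃ f : (res A h).obj M ⟶ (res A h').obj N, resHom f h₁ = f₁ ∧ resHom f h₂ = f₂ := by
  let g {V' : Opens X} (i : V' ≤ V) (f : (res A (i.trans h)).obj M ⟶ (res A (i.trans h')).obj N) :
      (res A i).obj ((res A h).obj M) ⟶ (res A i).obj ((res A h').obj N) :=
    (resComp A h i).hom.app M ≫ f ≫ (resComp A h' i).inv.app N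
  have hg {V' : Opens X} (i : V' ≤ V) (f : (res A (i.trans h)).obj M ⟶ (res A (i.trans h')).obj N)
      (j : W ≤ V') : resHom (g i f) j =
        (resComp A h (j.trans i)).hom.app M ≫ resHom f j ≫
          (resComp A h' (j.trans i)).inv.app N := by
    rw [resHom_comp, resHom_comp, resHom_resComp, resHom_resComp_inv]
  have hg' {V' : Opens X} (i : V' ≤ V) (f : (res A (i.trans h)).obj M ⟶ (res A (i.trans h')).obj N)
      (k : (res A h).obj M ⟶ (res A h').obj N) (hk : (res A i).map k = g i f) :
      resHom k i = f := by
    unfold resHom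
    rw [hk]
    simp [g]
  obtain ⟨f, hf₁, hf₂⟩ := exists_map_eq h₁ h₂ hW₁ hW₂ hinf hcov (g h₁ f₁) (g h₂ f₂)
    (by rw [hg, hg, hf])
  exact ⟨f, hg' h₁ f₁ f hf₁, hg' h₂ f₂ f hf₂⟩

/-- Morphisms `M|_V ⟶ N|_V` are determined by their restrictions to the members of a covering if
there are locally no morphisms from `M` to `N⟦-1⟧`. -/
lemma hom_ext_of_cover [NoetherianSpace X] (hMN : HomVanishes M (N⟦(-1 : ℤ)⟧)) {ι : Type*}
    (V' : ι → Opens X) (hcov : V ≤ ⨆ i, V' i) (f g : (res A h).obj M ⟶ (res A h').obj N)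
    (hfg : ∀ i, resHom f (inf_le_left : V ⊓ V' i ≤ V) = resHom g inf_le_left) : f = g := by
  obtain ⟨s, hs⟩ := exists_finset_le_sup V' hcov
  have key (s : Finset ι) : ∀ (W : Opens X) (hW : W ≤ V), W ≤ s.sup V' → resHom (f - g) hW = 0 := by
    classical
    induction s using Finset.induction_on with
    | empty => exact fun W hW hs => (isZero_of_le_bot hs _).eq_of_src _ _
    | insert k s _ ih =>
      intro W hW hs
      rw [Finset.sup_insert] at hs
      refine eq_zero_of_resHom (inf_le_left : W ⊓ V' k ≤ W) (inf_le_left : W ⊓ s.sup V' ≤ W)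
        (by rw [← inf_sup_left]; exact le_inf le_rfl hs) hMN _ ?_ ?_
      · have := congrArg (fun a => resHom a (le_inf (inf_le_left.trans hW) inf_le_right :
          W ⊓ V' k ≤ V ⊓ V' k)) (hfg k)
        rw [resHom_resHom, resHom_sub, sub_eq_zero]
        simpa only [resHom_resHom] using this
      · rw [resHom_resHom]
        exact ih _ _ inf_le_right
  rw [← sub_eq_zero]
  exact (resHom_le_rfl _).symm.trans (key s V le_rfl hs)

/-- Compatible morphisms over the members of a covering can be glued if there are locally no
morphisms from `M` to `N⟦-1⟧`. -/
lemma exists_hom_of_cover [NoetherianSpace X] (hMN : HomVanishes M (N⟦(-1 : ℤ)⟧)) {ι : Type*}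
    (V' : ι → Opens X) (hU : ∀ i, V' i ≤ U) (hU' : ∀ i, V' i ≤ U') (hcov : V ≤ ⨆ i, V' i)
    (f : ∀ i, (res A (hU i)).obj M ⟶ (res A (hU' i)).obj N)
    (hf : ∀ i j, resHom (f i) (inf_le_left : V' i ⊓ V' j ≤ V' i) = resHom (f j) inf_le_right) :
    ∃ F : (res A h).obj M ⟶ (res A h').obj N, ∀ (i : ι) (Z : Opens X) (hZ : Z ≤ V) (hZ' : Z ≤ V' i),
      resHom F hZ = resHom (f i) hZ' := by
  obtain ⟨s₀, hs₀⟩ := exists_finset_le_sup V' hcov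
  have hf' (i j : ι) (Z : Opens X) (hi : Z ≤ V' i) (hj : Z ≤ V' j) :
      resHom (f i) hi = resHom (f j) hj := by
    have := congrArg (fun a => resHom a (le_inf hi hj)) (hf i j)
    simpa only [resHom_resHom] using this
  have key (s : Finset ι) : ∀ (W : Opens X) (hW : W ≤ V), W ≤ s.sup V' →
      ∃ F : (res A (hW.trans h)).obj M ⟶ (res A (hW.trans h')).obj N, ∀ i ∈ s,
        ∀ (Z : Opens X) (hZ : Z ≤ W) (hZ' : Z ≤ V' i), resHom F hZ = resHom (f i) hZ' := by
    classical
    induction s using Finset.induction_on with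
    | empty => exact fun W hW hs => ⟨0, by simp⟩
    | insert k s _ ih =>
      intro W hW hs
      rw [Finset.sup_insert] at hs
      obtain ⟨F, hF⟩ := ih (W ⊓ s.sup V') (inf_le_left.trans hW) inf_le_right
      let W' := (W ⊓ V' k) ⊓ (W ⊓ s.sup V')
      have e : resHom (resHom (f k) inf_le_right : (res A ((inf_le_left.trans hW :
          W ⊓ V' k ≤ V).trans h)).obj M ⟶ (res A ((inf_le_left.trans hW :
          W ⊓ V' k ≤ V).trans h')).obj N) (inf_le_left : W' ≤ W ⊓ V' k) =
          resHom F (inf_le_right : W' ≤ W ⊓ s.sup V') := by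
        refine hom_ext_of_cover hMN (fun i : s => V' i)
          (inf_le_right.trans (inf_le_right.trans (finset_sup_le_iSup _ _))) _ _ fun i => ?_
        rw [resHom_resHom, resHom_resHom, resHom_resHom,
          hF i i.2 _ (inf_le_left.trans inf_le_right) inf_le_right]
        exact hf' _ _ _ _ _
      obtain ⟨G, hG₁, hG₂⟩ := exists_resHom_eq (h := hW.trans h) (h' := hW.trans h')
        (inf_le_left : W ⊓ V' k ≤ W) (inf_le_left : W ⊓ s.sup V' ≤ W)
        (by rw [← inf_sup_left]; exact le_inf le_rfl hs) (inf_le_left : W' ≤ _) inf_le_right le_rfl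
        _ _ e
      refine ⟨G, fun i hi Z hZ hZ' => ?_⟩
      obtain rfl | hi := Finset.mem_insert.1 hi
      · have := congrArg (fun a => resHom a (le_inf hZ hZ')) hG₁
        simpa only [resHom_resHom] using this
      · have := congrArg (fun a => resHom a (le_inf hZ (hZ'.trans (Finset.le_sup hi)))) hG₂
        rw [hF i hi _ _ hZ'] at this
        simpa only [resHom_resHom] using this
  obtain ⟨F, hF⟩ := key s₀ V le_rfl hs₀
  refine ⟨F, fun i Z hZ hZ' => ?_⟩
  refine hom_ext_of_cover hMN (fun i : s₀ => V' i)
    (hZ.trans (hs₀.trans (finset_sup_le_iSup _ _))) _ _ fun j => ?_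
  rw [resHom_resHom, resHom_resHom, hF j j.2 _ _ inf_le_right]
  exact hf' _ _ _ _ _

end

/-! ### Vanishing of negative morphisms -/

section

variable {X : TopCat.{u}} {A : X.Sheaf RingCat.{u}}

lemma homVanishes_of_isLE_of_isGE {U U' : Opens X} {M : D A U} {N : D A U'} {a b : ℤ}
    (hM : M.IsLE b) (hN : N.IsGE a) {n : ℤ} (hn : n < a - b) : HomVanishes M (N⟦n⟧) := by
  intro W h h' f
  have h1 : ((res A h).obj M).IsLE b := isLE_res A h M b hM
  have h2 : ((res A h').obj (N⟦n⟧)).IsGE (a - n) :=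
    isGE_res A h' _ _ (DerivedCategory.TStructure.t.isGE_shift N a n (a - n))
  exact DerivedCategory.TStructure.t.zero f b (a - n)

lemma HomVanishes.of_iso {U U' : Opens X} {M : D A U} {N N' : D A U'} (hMN : HomVanishes M N)
    (e : N ≅ N') : HomVanishes M N' := fun W h h' f => by
  rw [← cancel_mono ((res A h').map e.inv)]
  exact (hMN _ _ _ _).trans (hMN _ _ _ _).symm

/-- Morphisms vanish if they do so over the members of a basis and there are locally no morphisms
to `N⟦-1⟧`. -/
lemma HomVanishes.of_basis [NoetherianSpace X] {B : Set (Opens X)} (hB : Opens.IsBasis B)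
    {U U' : Opens X} {M : D A U} {N : D A U'} (hMN : HomVanishes M (N⟦(-1 : ℤ)⟧))
    (hf : ∀ W ∈ B, ∀ (h : W ≤ U) (h' : W ≤ U') (f : (res A h).obj M ⟶ (res A h').obj N), f = 0) :
    HomVanishes M N := fun W h h' f => by
  have hcov : W ≤ ⨆ V : {V : Opens X // V ∈ B ∧ V ≤ W}, V.1 := fun x hx => by
    obtain ⟨V, hV, hxV, hVW⟩ := Opens.isBasis_iff_nbhd.1 hB hx
    exact Opens.mem_iSup.2 ⟨⟨V, hV, hVW⟩, hxV⟩
  refine hom_ext_of_cover hMN _ hcov _ _ fun V => ?_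
  have e : resHom f V.2.2 = 0 := hf _ V.2.1 _ _ _
  have e' := congrArg (fun a => resHom a (inf_le_right : W ⊓ V.1 ≤ V.1)) e
  rw [resHom_resHom] at e'
  rw [e', resHom_zero, resHom_zero]

variable {C : ThickAbelianSubstack A} {B : Set (Opens X)}

lemma eq_zero_of_le_of_ge {W : Opens X} (t : TStructure (Dbc C W).FullSubcategory)
    {M N : (Dbc C W).FullSubcategory} (hM : t.le 0 M) (hN : t.ge 0 N) {n : ℤ} (hn : n < 0)
    (f : M.obj ⟶ N.obj⟦n⟧) : f = 0 := by
  have : t.IsLE M 0 := ⟨hM⟩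
  have : t.IsGE (N⟦n⟧) (-n) := ⟨t.ge_shift 0 n (-n) (by lia) _ hN⟩
  let g : M ⟶ N⟦n⟧ := (Dbc C W).ι.preimage (f ≫ ((Dbc C W).ι.commShiftIso n).inv.app N)
  have hg : (Dbc C W).ι.map g = f ≫ ((Dbc C W).ι.commShiftIso n).inv.app N :=
    Functor.map_preimage _ _
  have hg0 : g = 0 := t.zero g 0 (-n)
  rw [hg0, Functor.map_zero] at hg
  rw [← cancel_mono (((Dbc C W).ι.commShiftIso n).inv.app N), zero_comp]
  exact hg.symm

variable (T : LocalTStructures C B)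

/-- The `≤ 0` part of the glued t-structure has no morphisms to negative shifts of the `≥ 0` part,
also locally. -/
lemma homVanishes_shift [NoetherianSpace X] (hB : Opens.IsBasis B) {U U' : Opens X}
    {M : (Dbc C U).FullSubcategory} {N : (Dbc C U').FullSubcategory} (hM : T.gluedLE U M)
    (hN : T.gluedGE U' N) {n : ℤ} (hn : n < 0) : HomVanishes M.obj (N.obj⟦n⟧) := by
  obtain ⟨b, hb⟩ := M.property.1.2
  obtain ⟨a, ha⟩ := N.property.1.1
  -- induction on the distance to the range where the standard t-structure gives the claim
  have key (k : ℕ) : ∀ n : ℤ, n < 0 → n < a - b + k → HomVanishes M.obj (N.obj⟦n⟧) := by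
    induction k with
    | zero => exact fun n _ hn => homVanishes_of_isLE_of_isGE hb ha (by simpa using hn)
    | succ k ih =>
      intro n hn hn'
      refine HomVanishes.of_basis hB
        ((ih (n - 1) (by lia) (by push_cast at hn'; lia)).of_iso
          ((shiftFunctorAdd' _ n (-1) (n - 1) (by lia)).app N.obj)) fun W hW h h' f => ?_
      rw [← cancel_mono (((res A h').commShiftIso n).hom.app N.obj), zero_comp]
      exact eq_zero_of_le_of_ge (T.t W hW) (hM W hW h) (hN W hW h') hn _
  exact key (n - (a - b) + 1).toNat n hn (by have := Int.self_le_toNat (n - (a - b) + 1); lia)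

lemma homVanishes_of_heart [NoetherianSpace X] (hB : Opens.IsBasis B) {U U' : Opens X}
    {M : D A U} {N : D A U'} (hM : T.heart U M) (hN : T.heart U' N) :
    HomVanishes M (N⟦(-1 : ℤ)⟧) :=
  homVanishes_shift T hB hM.choose_spec.1 hN.choose_spec.2 (by lia)

end

/-! ### Local nature of the heart -/

section

variable {X : TopCat.{u}} {A : X.Sheaf RingCat.{u}}

lemma isIso_of_resHom {U U' V : Opens X} {M : D A U} {N : D A U'} {h : V ≤ U} {h' : V ≤ U'}
    {ι : Type*} (V' : ι → Opens X) (hcov : V ≤ ⨆ i, V' i)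
    (f : (res A h).obj M ⟶ (res A h').obj N)
    (hf : ∀ i, IsIso (resHom f (inf_le_left : V ⊓ V' i ≤ V))) : IsIso f := by
  refine isIso_of_cover A (fun i => V ⊓ V' i) (fun i => inf_le_left)
    (by rw [← inf_iSup_eq]; exact le_inf le_rfl hcov) f fun i => ?_
  have := hf i
  rw [res_map_eq_resHom]
  infer_instance

variable {C : ThickAbelianSubstack A}

section

variable [NoetherianSpace X] {U : Opens X} {ι : Type u} (V : ι → Opens X) (hV : ∀ i, V i ≤ U)
    (hcov : U = ⨆ i, V i)

include hcov

/-- Membership in a thick abelian substack `C` of `Mod 𝒜` is a local property: descent for objects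
in `C` yields an object with the same restrictions as `F`, and it is isomorphic to `F` by descent
for morphisms between objects in degree `0`. -/
lemma obj_of_cover (F : ModOn A U) (hF : ∀ i, C.obj (V i) ((ModOn.res A (hV i)).obj F)) :
    C.obj U F := by
  let M : D A U := (DerivedCategory.singleFunctor _ 0).obj F
  let φ (i j : ι) : (res A (inf_le_left : V i ⊓ V j ≤ V i)).obj ((res A (hV i)).obj M) ≅
      (res A (inf_le_right : V i ⊓ V j ≤ V j)).obj ((res A (hV j)).obj M) :=
    (resComp A (hV i) inf_le_left).app M ≪≫ ((resComp A (hV j) inf_le_right).app M).symm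
  have hφ (i j : ι) {Z : Opens X} (hZ : Z ≤ V i ⊓ V j) : resHom (φ i j).hom hZ =
      (resComp A (hV i) (hZ.trans inf_le_left)).hom.app M ≫
        (resComp A (hV j) (hZ.trans inf_le_right)).inv.app M := by
    refine (resHom_comp (N := M) (h' := (inf_le_left : V i ⊓ V j ≤ V i).trans (hV i))
      ((resComp A (hV i) inf_le_left).hom.app M) ((resComp A (hV j) inf_le_right).inv.app M)
      hZ).trans ?_
    rw [resHom_resComp, resHom_resComp_inv]
  obtain ⟨N, ⟨G, hG, ⟨e⟩⟩, ψ, hψ⟩ := C.isStack.descent_obj V hV hcov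
    (fun i => (res A (hV i)).obj M) (fun i => ⟨_, hF i,
      ⟨((ModOn.res A (hV i)).mapDerivedCategorySingleFunctor 0).symm.app F⟩⟩) φ
    (fun i j k => by
      rw [hφ, hφ, hφ, Category.assoc, Iso.inv_hom_id_app_assoc])
  have hN : N.IsLE 0 := DerivedCategory.TStructure.t.isLE_of_iso e 0
  have hψ' (i j : ι) : resHom (ψ i).hom (inf_le_left : V i ⊓ V j ≤ V i) =
      resHom (ψ j).hom (inf_le_right : V i ⊓ V j ≤ V j) := by
    unfold resHom
    rw [← Category.assoc, ← Category.assoc, ← hψ i j]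
    simp [φ]
  obtain ⟨f, hf⟩ := exists_hom_of_cover (h := le_rfl) (h' := le_rfl)
    (homVanishes_of_isLE_of_isGE (M := N) (N := M) (a := 0) (b := 0) hN inferInstance (by lia))
    V hV hV hcov.le (fun i => (ψ i).hom) hψ'
  have : IsIso f := isIso_of_resHom V hcov.le f fun i => by
    rw [hf i _ _ inf_le_right]
    infer_instance
  let e' : G ≅ F := (DerivedCategory.singleFunctor _ 0).preimageIso
    (e ≪≫ (selfIso N).symm ≪≫ asIso f ≪≫ selfIso M)
  exact (C.obj U).prop_of_iso e' hG

/-- Membership in `D^b_c` is a local property. -/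
lemma Dbc_of_cover (M : D A U) (hM : ∀ i, Dbc C (V i) ((res A (hV i)).obj M)) : Dbc C U M := by
  obtain ⟨s, hs⟩ := exists_finset_le_sup V hcov.le
  have hs' := hs.trans (finset_sup_le_iSup V s)
  choose b hb using fun i => (hM i).1.2
  choose a ha using fun i => (hM i).1.1
  obtain ⟨b₀, hb₀⟩ := (s.image b).exists_le
  obtain ⟨a₀, ha₀⟩ := (s.image (fun i => - a i)).exists_le
  refine ⟨⟨⟨-a₀, ?_⟩, ⟨b₀, ?_⟩⟩, fun n => ?_⟩
  · refine isGE_of_cover A (fun i : s => V i) (fun i => hV i) hs' _ fun i => ?_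
    have := ha i
    have h1 := ha₀ _ (Finset.mem_image_of_mem _ i.2)
    exact DerivedCategory.TStructure.t.isGE_of_ge _ (-a₀) (a i) (by lia)
  · refine isLE_of_cover A (fun i : s => V i) (fun i => hV i) hs' _ fun i => ?_
    have := hb i
    have h1 := hb₀ _ (Finset.mem_image_of_mem _ i.2)
    exact DerivedCategory.TStructure.t.isLE_of_le _ (b i) b₀ (by lia)
  · exact obj_of_cover V hV hcov _ fun i =>
      (C.obj (V i)).prop_of_iso (homologyResIso A (hV i) M n) ((hM i).2 n)

end

/-- The canonical isomorphism `(M|_V)|_W ≅ M|_W` in `D^b_c(Mod 𝒜|_W)`. -/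
def Dbc.resComp {U V W : Opens X} (h : V ≤ U) (h' : W ≤ V) (M : (Dbc C U).FullSubcategory) :
    (Dbc.res C h').obj ((Dbc.res C h).obj M) ≅ (Dbc.res C (h'.trans h)).obj M :=
  (Dbc C W).isoMk ((RingedStack.resComp A h h').app M.obj)

variable {B : Set (Opens X)} (T : LocalTStructures C B)

lemma heart_of_iso {U : Opens X} {M N : D A U} (e : M ≅ N) (hM : T.heart U M) : T.heart U N := by
  obtain ⟨hM, hle, hge⟩ := hM
  have hN := (Dbc C U).prop_of_iso e hM
  let e' : (⟨M, hM⟩ : (Dbc C U).FullSubcategory) ≅ ⟨N, hN⟩ := (Dbc C U).isoMk e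
  exact ⟨hN, fun W hW h => ((T.t W hW).le 0).prop_of_iso ((Dbc.res C h).mapIso e') (hle W hW h),
    fun W hW h => ((T.t W hW).ge 0).prop_of_iso ((Dbc.res C h).mapIso e') (hge W hW h)⟩

lemma heart_res {U V : Opens X} (h : V ≤ U) {M : D A U} (hM : T.heart U M) :
    T.heart V ((res A h).obj M) := by
  obtain ⟨hM, hle, hge⟩ := hM
  exact ⟨res_mem_Dbc C h M hM,
    fun W hW h' => ((T.t W hW).le 0).prop_of_iso (Dbc.resComp h h' ⟨M, hM⟩).symm (hle W hW _),
    fun W hW h' => ((T.t W hW).ge 0).prop_of_iso (Dbc.resComp h h' ⟨M, hM⟩).symm (hge W hW _)⟩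

/-- Membership in the heart of the glued t-structure is a local property. -/
lemma heart_of_cover [NoetherianSpace X] (hB : Opens.IsBasis B) {U : Opens X} {ι : Type u}
    (V : ι → Opens X) (hV : ∀ i, V i ≤ U) (hcov : U = ⨆ i, V i) {M : D A U}
    (hM : ∀ i, T.heart (V i) ((res A (hV i)).obj M)) : T.heart U M := by
  have hMc : Dbc C U M := Dbc_of_cover V hV hcov M fun i => (hM i).choose
  -- the members of the basis which are contained in `W` and in a member of the given covering
  let κ (W : Opens X) : Type u := {W' : Opens X // W' ∈ B ∧ W' ≤ W ∧ ∃ i, W' ≤ V i}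
  have hκ (W : Opens X) (hW : W ≤ U) : W = ⨆ W' : κ W, W'.1 := by
    refine le_antisymm (fun x hx => ?_) (iSup_le fun W' => W'.2.2.1)
    obtain ⟨i, hi⟩ := Opens.mem_iSup.1 ((hW.trans hcov.le) hx)
    obtain ⟨W', hW', hxW', hle⟩ := Opens.isBasis_iff_nbhd.1 hB
      (show x ∈ W ⊓ V i from ⟨hx, hi⟩)
    exact Opens.mem_iSup.2 ⟨⟨W', hW', hle.trans inf_le_left, i, hle.trans inf_le_right⟩, hxW'⟩
  refine ⟨hMc, fun W hW h => ?_, fun W hW h => ?_⟩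
  · refine (T.le_iff W hW (fun W' : κ W => W'.1) (fun W' => W'.2.1) (fun W' => W'.2.2.1)
      (hκ W h) _).2 fun W' => ?_
    obtain ⟨i, hi⟩ := W'.2.2.2
    obtain ⟨hMi, hle, -⟩ := hM i
    exact ((T.t W'.1 W'.2.1).le 0).prop_of_iso (Dbc.resComp (hV i) hi ⟨M, hMc⟩ ≪≫
      (Dbc.resComp h W'.2.2.1 ⟨M, hMc⟩).symm) (hle _ _ _)
  · refine (T.ge_iff W hW (fun W' : κ W => W'.1) (fun W' => W'.2.1) (fun W' => W'.2.2.1)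
      (hκ W h) _).2 fun W' => ?_
    obtain ⟨i, hi⟩ := W'.2.2.2
    obtain ⟨hMi, -, hge⟩ := hM i
    exact ((T.t W'.1 W'.2.1).ge 0).prop_of_iso (Dbc.resComp (hV i) hi ⟨M, hMc⟩ ≪≫
      (Dbc.resComp h W'.2.2.1 ⟨M, hMc⟩).symm) (hge _ _ _)

end

/-! ### Descent for objects -/

section

variable {X : TopCat.{u}} {A : X.Sheaf RingCat.{u}}

lemma resHom_comp_selfIso_inv {U V W : Opens X} {h : V ≤ U} {M : D A U} {N : D A V}
    (f : (res A h).obj M ⟶ N) (hW : W ≤ V) :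
    resHom (f ≫ (selfIso N).inv) hW = (resComp A h hW).inv.app M ≫ (res A hW).map f := by
  unfold resHom
  have e : (res A hW).map (selfIso N).inv ≫ (resComp A le_rfl hW).hom.app N = 𝟙 _ := by
    rw [← res_map_selfIso, ← Functor.map_comp, Iso.inv_hom_id, CategoryTheory.Functor.map_id]
  rw [Functor.map_comp, Category.assoc, e, Category.comp_id]

lemma resComp_inv_comp_map_selfIso {U V W : Opens X} {h : V ≤ U} {M : D A U} {N : D A V}
    (f : (res A h).obj M ⟶ (res A le_rfl).obj N) (hW : W ≤ V) :
    (resComp A h hW).inv.app M ≫ (res A hW).map (f ≫ (selfIso N).hom) = resHom f hW := by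
  rw [← resHom_comp_selfIso_inv, Category.assoc, Iso.hom_inv_id, Category.comp_id]

variable {C : ThickAbelianSubstack A} {B : Set (Opens X)} {T : LocalTStructures C B}

/-- The descent datum `(M, Φ)` is effective over `W`: there is an object of the heart over `W` whose
restrictions to all `W ∩ V k` are isomorphic to those of `M k`, compatibly with the transition
morphisms `Φ`. No relation between `W` and the `V k` is assumed. -/
def HasDescent (T : LocalTStructures C B) {ι : Type u} {V : ι → Opens X} {M : ∀ i, D A (V i)}
    (Φ : ∀ (i j : ι) (Z : Opens X) (hi : Z ≤ V i) (hj : Z ≤ V j),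
      (res A hi).obj (M i) ⟶ (res A hj).obj (M j)) (W : Opens X) : Prop :=
  ∃ (N : D A W) (_ : T.heart W N)
    (θ : ∀ k, (res A (inf_le_left : W ⊓ V k ≤ W)).obj N ⟶ (res A inf_le_right).obj (M k)),
    (∀ k, IsIso (θ k)) ∧ ∀ (k l : ι) (Z : Opens X) (hW : Z ≤ W) (hk : Z ≤ V k) (hl : Z ≤ V l),
      resHom (θ k) (le_inf hW hk) ≫ Φ k l Z hk hl = resHom (θ l) (le_inf hW hl)

variable [NoetherianSpace X] (hB : Opens.IsBasis B)

include hB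

variable {ι : Type u} {V : ι → Opens X} {M : ∀ i, D A (V i)} (hM : ∀ i, T.heart (V i) (M i))
    (Φ : ∀ (i j : ι) (Z : Opens X) (hi : Z ≤ V i) (hj : Z ≤ V j),
      (res A hi).obj (M i) ⟶ (res A hj).obj (M j))

lemma hasDescent_bot : HasDescent T Φ ⊥ := by
  obtain ⟨Z, -, -⟩ := ObjectProperty.ContainsZero.exists_zero (P := Dbc C ⊥)
  refine ⟨Z, heart_of_cover T hB (fun i : PEmpty => i.elim) (fun i => i.elim)
    (le_antisymm bot_le (iSup_le fun i => i.elim))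
    (fun i => i.elim), fun k => 0, fun k => ?_, fun k l Z hW hk hl => ?_⟩
  · exact ⟨0, (isZero_of_le_bot inf_le_left _).eq_of_src _ _,
      (isZero_of_le_bot inf_le_left _).eq_of_src _ _⟩
  · exact (isZero_of_le_bot hW _).eq_of_src _ _

variable (hres : ∀ (i j : ι) (Z : Opens X) (hi : Z ≤ V i) (hj : Z ≤ V j) (Z' : Opens X)
      (hZ : Z' ≤ Z), resHom (Φ i j Z hi hj) hZ = Φ i j Z' (hZ.trans hi) (hZ.trans hj))
    (hcomp : ∀ (i j k : ι) (Z : Opens X) (hi : Z ≤ V i) (hj : Z ≤ V j) (hk : Z ≤ V k),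
      Φ i j Z hi hj ≫ Φ j k Z hj hk = Φ i k Z hi hk)
    (hiso : ∀ (i j : ι) (Z : Opens X) (hi : Z ≤ V i) (hj : Z ≤ V j), IsIso (Φ i j Z hi hj))

include hM hres hcomp hiso

/-- Effectivity over `W` implies effectivity over `W ∪ V k`, by gluing the object over `W` with
`M k`. -/
lemma HasDescent.sup {W : Opens X} (hW : HasDescent T Φ W) (k : ι) :
    HasDescent T Φ (W ⊔ V k) := by
  obtain ⟨N, hN, θ, hθ, hc⟩ := hW
  obtain ⟨N', α₁, α₂, hα⟩ := exists_glue (le_sup_left : W ≤ W ⊔ V k) le_sup_right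
    (inf_le_left : W ⊓ V k ≤ W) inf_le_right le_rfl (asIso (θ k))
  let a₁ : (res A (le_sup_left : W ≤ W ⊔ V k)).obj N' ⟶ (res A le_rfl).obj N :=
    α₁.hom ≫ (selfIso N).inv
  let a₂ : (res A (le_sup_right : V k ≤ W ⊔ V k)).obj N' ⟶ (res A le_rfl).obj (M k) :=
    α₂.hom ≫ (selfIso (M k)).inv
  have ha : resHom a₁ inf_le_left ≫ θ k = resHom a₂ inf_le_right := by
    rw [resHom_comp_selfIso_inv, resHom_comp_selfIso_inv, Category.assoc]
    exact hα
  have ha' (Z : Opens X) (h₁ : Z ≤ W) (h₂ : Z ≤ V k) :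
      resHom a₁ h₁ ≫ resHom (θ k) (le_inf h₁ h₂) = resHom a₂ h₂ := by
    have := congrArg (fun f => resHom f (le_inf h₁ h₂)) ha
    simpa only [resHom_comp, resHom_resHom] using this
  have hN' : T.heart _ N' := heart_of_cover T hB (fun b : ULift.{u} Bool => cond b.down W (V k))
    (by rintro ⟨_ | _⟩; exacts [le_sup_right, le_sup_left])
    (by
      refine le_antisymm (sup_le ?_ ?_) (iSup_le ?_)
      · exact le_iSup (fun b : ULift.{u} Bool => cond b.down W (V k)) ⟨true⟩
      · exact le_iSup (fun b : ULift.{u} Bool => cond b.down W (V k)) ⟨false⟩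
      · rintro ⟨_ | _⟩; exacts [le_sup_right, le_sup_left])
    (by rintro ⟨_ | _⟩; exacts [heart_of_iso T α₂.symm (hM k), heart_of_iso T α₁.symm hN])
  -- over `(W ∪ V k) ∩ V l` the isomorphism to `M l` is glued from those over `W ∩ V l` and
  -- `V k ∩ V l`
  let θ₁ (l : ι) : (res A (inf_le_left.trans le_sup_left : W ⊓ V l ≤ W ⊔ V k)).obj N' ⟶
      (res A inf_le_right).obj (M l) := resHom a₁ inf_le_left ≫ θ l
  let θ₂ (l : ι) : (res A (inf_le_left.trans le_sup_right : V k ⊓ V l ≤ W ⊔ V k)).obj N' ⟶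
      (res A inf_le_right).obj (M l) := resHom a₂ inf_le_left ≫ Φ k l _ inf_le_left inf_le_right
  have hθ₁ (l : ι) : IsIso (θ₁ l) := by have := hθ l; dsimp only [θ₁, a₁]; infer_instance
  have hθ₂ (l : ι) : IsIso (θ₂ l) := by
    have := hiso k l _ (inf_le_left : V k ⊓ V l ≤ V k) inf_le_right
    dsimp only [θ₂, a₂]; infer_instance
  have hex (l : ι) : ∃ θ' : (res A (inf_le_left : (W ⊔ V k) ⊓ V l ≤ W ⊔ V k)).obj N' ⟶
      (res A inf_le_right).obj (M l), resHom θ' (inf_le_inf_right _ le_sup_left) = θ₁ l ∧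
        resHom θ' (inf_le_inf_right _ le_sup_right) = θ₂ l := by
    refine exists_resHom_eq (inf_le_inf_right (V l) (le_sup_left : W ≤ W ⊔ V k))
      (inf_le_inf_right (V l) (le_sup_right : V k ≤ W ⊔ V k)) (inf_sup_right _ _ _).le
      (inf_le_left : (W ⊓ V l) ⊓ (V k ⊓ V l) ≤ _) inf_le_right le_rfl (θ₁ l) (θ₂ l) ?_
    dsimp only [θ₁, θ₂]
    rw [resHom_comp, resHom_comp, resHom_resHom, resHom_resHom, hres,
      ← ha' _ (inf_le_left.trans inf_le_left) (inf_le_right.trans inf_le_left), Category.assoc,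
      hc k l ((W ⊓ V l) ⊓ (V k ⊓ V l)) (inf_le_left.trans inf_le_left)
        (inf_le_right.trans inf_le_left) (inf_le_left.trans inf_le_right)]
  choose θ' hθ'₁ hθ'₂ using hex
  refine ⟨N', hN', θ', fun l => ?_, fun l m Z hZ hl hm => ?_⟩
  · refine isIso_of_resHom (fun b : Bool => cond b W (V k))
      (by rw [iSup_bool_eq]; exact inf_le_left) _ ?_
    rintro (_ | _)
    · have := congrArg (fun f => resHom f (le_inf inf_le_right (inf_le_left.trans inf_le_right) :
        ((W ⊔ V k) ⊓ V l) ⊓ V k ≤ V k ⊓ V l)) (hθ'₂ l)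
      rw [resHom_resHom] at this
      change IsIso (resHom (θ' l) _)
      rw [this]
      infer_instance
    · have := congrArg (fun f => resHom f (le_inf inf_le_right (inf_le_left.trans inf_le_right) :
        ((W ⊔ V k) ⊓ V l) ⊓ W ≤ W ⊓ V l)) (hθ'₁ l)
      rw [resHom_resHom] at this
      change IsIso (resHom (θ' l) _)
      rw [this]
      infer_instance
  · have h₁ (l : ι) (Y : Opens X) (hW : Y ≤ W) (hl : Y ≤ V l) :
        resHom (θ' l) (le_inf (hW.trans le_sup_left) hl) =
          resHom a₁ hW ≫ resHom (θ l) (le_inf hW hl) := by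
      have := congrArg (fun f => resHom f (le_inf hW hl)) (hθ'₁ l)
      simpa only [θ₁, resHom_comp, resHom_resHom] using this
    have h₂ (l : ι) (Y : Opens X) (hk : Y ≤ V k) (hl : Y ≤ V l) :
        resHom (θ' l) (le_inf (hk.trans le_sup_right) hl) =
          resHom a₂ hk ≫ Φ k l Y hk hl := by
      have := congrArg (fun f => resHom f (le_inf hk hl)) (hθ'₂ l)
      simpa only [θ₂, resHom_comp, resHom_resHom, hres] using this
    refine hom_ext_of_cover (homVanishes_of_heart T hB hN' (hM m))
      (fun b : Bool => cond b W (V k)) (by rwa [iSup_bool_eq]) _ _ ?_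
    rintro (_ | _)
    · rw [resHom_comp, resHom_resHom, resHom_resHom, hres]
      refine (congrArg (fun f => f ≫ _) (h₂ l _ inf_le_right (inf_le_left.trans hl))).trans
        (Eq.trans ?_ (h₂ m _ inf_le_right (inf_le_left.trans hm)).symm)
      rw [Category.assoc]
      exact congrArg (fun f => _ ≫ f) (hcomp _ _ _ _ _ _ _)
    · rw [resHom_comp, resHom_resHom, resHom_resHom, hres]
      refine (congrArg (fun f => f ≫ _) (h₁ l _ inf_le_right (inf_le_left.trans hl))).trans
        (Eq.trans ?_ (h₁ m _ inf_le_right (inf_le_left.trans hm)).symm)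
      rw [Category.assoc]
      exact congrArg (fun f => _ ≫ f)
        (hc _ _ _ inf_le_right (inf_le_left.trans hl) (inf_le_left.trans hm))

lemma hasDescent_finset_sup (s : Finset ι) : HasDescent T Φ (s.sup V) := by
  classical
  induction s using Finset.induction_on with
  | empty => exact hasDescent_bot hB Φ
  | insert k s _ ih =>
    rw [Finset.sup_insert, sup_comm]
    exact ih.sup hB hM Φ hres hcomp hiso k

lemma hasDescent_of_cover {U : Opens X} (hV : ∀ i, V i ≤ U) (hcov : U ≤ ⨆ i, V i) :
    HasDescent T Φ U := by
  obtain ⟨s, hs⟩ := exists_finset_le_sup V hcov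
  obtain rfl : U = s.sup V := le_antisymm hs (Finset.sup_le fun i _ => hV i)
  exact hasDescent_finset_sup hB hM Φ hres hcomp hiso s

end

end RingedStack

end

theorem theorem4p11 {X : TopCat.{u}} [NoetherianSpace X] (A : X.Sheaf RingCat.{u})
    (C : ThickAbelianSubstack A) (B : Set (Opens X)) (hB : Opens.IsBasis B)
    (T : LocalTStructures C B) :
    IsStack (A := A) (fun V => T.heart V) where
  res_mem h M hM := heart_res T h hM
  descent_obj {U} {ι} V hV hcov M hM φ hφ := by
    let Φ (i j : ι) (Z : Opens X) (hi : Z ≤ V i) (hj : Z ≤ V j) :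
        (res A hi).obj (M i) ⟶ (res A hj).obj (M j) := resHom (φ i j).hom (le_inf hi hj)
    obtain ⟨N, hN, θ, hθ, hc⟩ := hasDescent_of_cover hB hM Φ
      (fun i j Z hi hj Z' hZ => resHom_resHom _ _ _)
      (fun i j k Z hi hj hk => by
        have := congrArg (fun f => resHom f (le_inf (le_inf hi hj) hk)) (hφ i j k)
        simp only [resHom_comp, resHom_resHom] at this
        exact this.symm)
      (fun i j Z hi hj => inferInstanceAs (IsIso (resHom (φ i j).hom _))) hV hcov.le
    refine ⟨N, hN, fun i => asIso (resHom (θ i) (le_inf (hV i) le_rfl)) ≪≫ selfIso (M i),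
      fun i j => ?_⟩
    have e (i : ι) (Z : Opens X) (hZ : Z ≤ V i) :
        (resComp A (hV i) hZ).inv.app N ≫ (res A hZ).map
          (asIso (resHom (θ i) (le_inf (hV i) le_rfl)) ≪≫ selfIso (M i)).hom =
        resHom (θ i) (le_inf (hZ.trans (hV i)) hZ) := by
      refine (resComp_inv_comp_map_selfIso (resHom (θ i) (le_inf (hV i) le_rfl)) hZ).trans ?_
      rw [resHom_resHom]
    rw [e, e, ← hc i j (V i ⊓ V j) (inf_le_left.trans (hV i)) inf_le_left inf_le_right]
    exact congrArg (fun f => _ ≫ f) (resHom_le_rfl _).symm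
  descent_hom {U} {ι} V hV hcov M N hM hN ψ hψ := by
    have hMN := homVanishes_of_heart T hB hM hN
    obtain ⟨F, hF⟩ := exists_hom_of_cover (h := le_rfl) (h' := le_rfl) hMN V hV hV hcov.le ψ hψ
    obtain ⟨f, rfl⟩ := (res A le_rfl).map_surjective F
    refine ⟨f, fun i => ?_, fun g hg => ?_⟩
    · rw [← resHom_map (h := le_rfl) f (hV i), hF i _ _ le_rfl, resHom_le_rfl]
    · apply (res A le_rfl).map_injective
      refine hom_ext_of_cover (h := le_rfl) (h' := le_rfl) hMN V hcov.le _ _ fun i => ?_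
      rw [hF i _ _ inf_le_right, ← hg i, resHom_map, resHom_map]
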